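/- Let $k$ be an algebraically closed field, $r\ge 0$ an integer, and $k[\mathbf x]=k[x_1,\dots,x_r]$. Let $\beta$ be a *basis set* of $n$ monomials, i.e. a finite nonempty set of monomials in $x_1,\dots,x_r$ that contains every divisor of each of its members, with $|\beta|=n$; let $I_\beta\subseteq k[\mathbf x]$ be the ideal generated by the monomials not in $\beta$. **The chart $U_\beta$.** Let $U_\beta=\operatorname{Spec}R$ be the affine open chart of $\operatorname{Hilb}^n(\mathbb A^r_k)$ that represents the functor sending a $k$-algebra $A$ to the set of ideals $J\subseteq A[\mathbf x]$ such that $A[\mathbf x]/J$ is a free $A$-module with basis $\beta$. For $\mathbf x^{\mathbf d}\notin\beta$, $\mathbf x^{\mathbf j}\in\beta$ let $c^{\mathbf d}_{\mathbf j}\in R$ be the coefficient of $\mathbf x^{\mathbf j}$ when $\mathbf x^{\mathbf d}$ is expanded in the basis $\beta$ modulo the universal ideal of $R[\mathbf x]$. Explicitly, $R=k[C^{\mathbf d}_{\mathbf j}:\mathbf d\notin\beta,\mathbf j\in\beta]/(\tau)$ with $c^{\mathbf d}_{\mathbf j}$ the class of $C^{\mathbf d}_{\mathbf j}$, where the relations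 are $\tau=C^{\mathbf d+\mathbf e_i}_{\mathbf j_0}-\sum_{\mathbf j\in\beta}C^{\mathbf d}_{\mathbf j}C^{\mathbf j+\mathbf e_i}_{\mathbf j_0}$ for $\mathbf d\notin\beta$, $\mathbf j_0\in\beta$, $1\le i\le r$ (with $C^{\mathbf b}_{\mathbf j}=\delta_{\mathbf b\mathbf j}$ for $\mathbf b\in\beta$), and the universal ideal is generated by the polynomials $\mathbf x^{\mathbf d}-\sum_{\mathbf j\in\beta}c^{\mathbf d}_{\mathbf j}\mathbf x^{\mathbf j}$. Let $t_\beta\in U_\beta$ be the point corresponding to $I_\beta$, i.e. the point where all $c^{\mathbf d}_{\mathbf j}$ with $\mathbf d\notin\beta$ vanish, and $M\subseteq R$ its maximal ideal, so that $M/M^2$ is the cotangent space at $t_\beta$. **Arrows.** The pair $(\mathbf d,\mathbf j)$ with $\mathbf d\notin\beta$, $\mathbf j\in\beta$ (equivalently $c^{\mathbf d}_{\mathbf j}$) is an *arrow* with *tail* $\mathbf x^{\mathbf d}$ and *head* $\mathbf x^{\mathbf j}$. It is *minimal* if $\mathbf x^{\mathbf d}$ is a minimal generator of $I_\beta$, and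 ($x_i$-)*standard* if $\mathbf j-\mathbf d$ has exactly one negative component (the $i$-th); its *$x_i$-offset* is $\mathbf j-\mathbf d$ with the $i$-th component deleted, its *$x_i$-height* is $d_i$, and its *$x_i$-shadow* is the set of arrows $(\mathbf d,\mathbf j-s\mathbf e_i)$, $0\le s\le j_i$. Two arrows are *translation-equivalent*, written $\sim$, if one can be moved to the other by unit steps $\pm\mathbf e_k$ applied simultaneously to tail and head, with all intermediate positions being arrows. An arrow is $\sim 0$ if it is $\sim(\mathbf d',\mathbf j')$ with, for some $k$, $j'_k=0$, $d'_k>0$ and $\mathbf d'-\mathbf e_k\notin\beta$. An $x_i$-standard arrow *can be advanced* if it is $\sim0$ or is $\sim$ an arrow of strictly smaller $x_i$-height. **Iterated shadow promotion.** Let $(\mathbf d,\mathbf j)$ be an $x_i$-standard arrow that can be advanced. On a translation path that advances it let $(\mathbf d_1,\mathbf j_1)$ be the first position with $(\mathbf d_1)_i=d_i$ and $\mathbf d_1-\mathbf e_i\in\mathbb N^r\setminus\beta$; choose a minimal generator $\mathbf x^{\mathbf b}$ of $I_\beta$ dividing $\mathbf x^{\mathbf d_1-\mathbf e_i}$, and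 let $\mathbf j_2$ have $i$-th component $(\mathbf j_1)_i$ and $k$-th component $(\mathbf j_1)_k-(\mathbf d_1)_k+b_k$ for $k\ne i$. The $x_i$-shadow of $(\mathbf b,\mathbf j_2)$ is called a *promotion image* of the $x_i$-shadow of $(\mathbf d,\mathbf j)$. For each $i$ let $x_i^{w_i}$ be the least power of $x_i$ not in $\beta$. For each $i$ and each offset $v$, start with the set of all arrows with tail $x_i^{w_i}$ and $x_i$-offset $v$; as long as some arrow of the current set can be advanced, take the one among these whose head has maximal $x_i$-degree and replace its $x_i$-shadow by a promotion image; stop when no arrow of the set can be advanced. A *standard bunch* is a union, over all $i$ and $v$, of final sets obtained in this way, for some choices of paths and generators. **Theorem.** (0) The explicitly presented ring $R$ with its universal ideal represents the functor above, and $t_\beta$ corresponds to $I_\beta$. (1) A standard bunch exists. (2) Every standard bunch $\mathcal S$ is a set of exactly $rn$ minimal standard arrows, whose images in $M/M^2$ are $k$-linearly independent. (3) Consequently $\dim_k M/M^2\ge rn$, and for every standard bunch $\mathcal S$ the point $t_\beta$ is nonsingular (its local ring $R_M=\mathcal O_{\operatorname{Hilb}^n(\mathbb A^r_k),t_\beta}$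 is regular) if and only if $\mathcal S$ spans $M/M^2$. -/

import Mathlib

open MvPolynomial

universe u

/-- A basis set: a finite nonempty set of monomials in `x_1, …, x_r` (given by their exponent
vectors) that is closed under taking divisors. -/
structure BasisSet (r : ℕ) where
  monos : Finset (Fin r →₀ ℕ)
  nonempty : monos.Nonempty
  mem_of_le : ∀ {j m : Fin r →₀ ℕ}, j ∈ monos → m ≤ j → m ∈ monos

/-- An arrow `c^d_j` for `β`: the tail `x^d` lies outside `β`, the head `x^j` lies in `β`. -/
@[ext]
structure Arrow {r : ℕ} (β : BasisSet r) where
  tail : Fin r →₀ ℕ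
  head : Fin r →₀ ℕ
  tail_notMem : tail ∉ β.monos
  head_mem : head ∈ β.monos

namespace Arrow

variable {r : ℕ} {β : BasisSet r}

/-- One discrete step in a variable direction, upwards or downwards; source and target both being
arrows, the head stays inside `β` and the tail outside `β`. -/
def Step (a b : Arrow β) : Prop :=
  ∃ i : Fin r,
    (b.tail = a.tail + Finsupp.single i 1 ∧ b.head = a.head + Finsupp.single i 1) ∨
    (a.tail = b.tail + Finsupp.single i 1 ∧ a.head = b.head + Finsupp.single i 1)

/-- Translation-equivalence `a ∼ b`. -/
def TransEquiv (a b : Arrow β) : Prop := Relation.ReflTransGen Step a b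

/-- `x^{tail}/x_i` is a monomial outside `β`. -/
def TailCanDrop (i : Fin r) (a : Arrow β) : Prop :=
  ∃ m : Fin r →₀ ℕ, m ∉ β.monos ∧ a.tail = m + Finsupp.single i 1

/-- `a ∼ 0`: the arrow can be translated to a position from which one more degree-decreasing step
moves the head out of the first orthant, the tail remaining a monomial outside `β`. -/
def EquivZero (a : Arrow β) : Prop :=
  ∃ b : Arrow β, TransEquiv a b ∧ ∃ i : Fin r, b.head i = 0 ∧ TailCanDrop i b

/-- `a` is standard for `x_i`: the `i`-th component of the vector `head - tail` is its only
negative component. -/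
def IsStandardFor (i : Fin r) (a : Arrow β) : Prop :=
  a.head i < a.tail i ∧ ∀ k, k ≠ i → a.tail k ≤ a.head k

/-- `a` is standard: the vector of `a` has exactly one negative component. -/
def IsStandard (a : Arrow β) : Prop := ∃ i, IsStandardFor i a

/-- `a` is minimal: its tail is a minimal generator of `I_β`, that is, a minimal monomial outside
`β` for the divisibility order. -/
def IsMinimal (a : Arrow β) : Prop := Minimal (fun d => d ∉ β.monos) a.tail

/-- The `x_i`-offset: the vector `head - tail` with the `i`-th component deleted. -/
def offset (i : Fin r) (a : Arrow β) : {k : Fin r // k ≠ i} → ℤ :=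
  fun k => (a.head k : ℤ) - (a.tail k : ℤ)

/-- The `x_i`-shadow of `a`: the arrows with the same tail whose head is `x^{head}/x_i^s` for some
`0 ≤ s ≤ deg_{x_i} x^{head}`. -/
def shadow (i : Fin r) (a : Arrow β) : Set (Arrow β) :=
  {b | b.tail = a.tail ∧ ∃ s : ℕ, a.head = b.head + Finsupp.single i s}

/-- `a` can be advanced (in the `x_i`-direction): `a ∼ 0`, or `a ∼ b` with `b` of strictly smaller
`x_i`-height, the `x_i`-height being the `x_i`-degree of the tail. -/
def CanAdvance (i : Fin r) (a : Arrow β) : Prop :=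
  EquivZero a ∨ ∃ b : Arrow β, TransEquiv a b ∧ b.tail i < a.tail i

/-- A position of `a` at the same `x_i`-height as `a` from which the tail can make one step in the
decreasing `x_i`-direction while staying outside `β`. -/
def IsExit (i : Fin r) (a p : Arrow β) : Prop := p.tail i = a.tail i ∧ TailCanDrop i p

/-- `p` is the first exit position on some translation path starting at `a`. (For an `x_i`-standard
arrow `a` such a path extends by one step to one that advances `a`, and every path that
advances `a` has a first exit position.) -/
def IsFirstExit (i : Fin r) (a p : Arrow β) : Prop :=
  Relation.ReflTransGen (fun q q' => Step q q' ∧ ¬ IsExit i a q) a p ∧ IsExit i a p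

/-- The `x_i`-shadow of `c` is a promotion image of the `x_i`-shadow of `a`. With `p = c^{d₁}_{j₁}`
the first exit position on a path advancing `a`, the tail of `c` is a minimal generator of `I_β`
dividing `x^{d₁}/x_i`, and the head of `c` is obtained from `x^{j₁}` by dividing out, in the
variables other than `x_i`, the quotient of `x^{d₁}` by the tail of `c`. -/
def Promotes (i : Fin r) (a c : Arrow β) : Prop :=
  ∃ p : Arrow β, IsFirstExit i a p ∧
    IsMinimal c ∧ c.tail + Finsupp.single i 1 ≤ p.tail ∧
    c.head i = p.head i ∧ ∀ k, k ≠ i → c.head k + p.tail k = p.head k + c.tail k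

/-- One round of shadow promotion: among the arrows of `T` that can be advanced choose the one, `a`,
whose head has maximal `x_i`-degree, and replace its `x_i`-shadow by a promotion image. -/
def PromotionRound (i : Fin r) (T T' : Set (Arrow β)) : Prop :=
  ∃ a ∈ T, CanAdvance i a ∧ (∀ b ∈ T, CanAdvance i b → b.head i ≤ a.head i) ∧
    ∃ c : Arrow β, Promotes i a c ∧ T' = (T \ shadow i a) ∪ shadow i c

end Arrow

namespace BasisSet

variable {r : ℕ} (β : BasisSet r)

/-- The `x_i`-width: the least `w` with `x_i^w ∉ β`. -/
noncomputable def width (i : Fin r) : ℕ := sInf {w | Finsupp.single i w ∉ β.monos}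

/-- The arrows whose tail is the `i`-th corner monomial `x_i^{w_i}` and whose offset is `v`. -/
def initialSet (i : Fin r) (v : {k : Fin r // k ≠ i} → ℤ) : Set (Arrow β) :=
  {a | a.tail = Finsupp.single i (β.width i) ∧ a.offset i = v}

/-- `T` is a final outcome of iterated shadow promotion from the `x_i`-standard arrows with tail
the `i`-th corner monomial and offset `v`. -/
def IsIteratedPromotion (i : Fin r) (v : {k : Fin r // k ≠ i} → ℤ) (T : Set (Arrow β)) : Prop :=
  Relation.ReflTransGen (Arrow.PromotionRound i) (β.initialSet i v) T ∧
    ∀ a ∈ T, ¬ a.CanAdvance i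

/-- A standard `x_i`-sub-bunch: a union, over all offsets `v`, of outcomes of iterated shadow
promotion. (If `v` is not the offset of an arrow at the corner, its only outcome is empty.) -/
def IsStandardSubBunch (i : Fin r) (S : Set (Arrow β)) : Prop :=
  ∃ T : ({k : Fin r // k ≠ i} → ℤ) → Set (Arrow β),
    (∀ v, β.IsIteratedPromotion i v (T v)) ∧ S = ⋃ v, T v

/-- A standard bunch: a union of standard `x_i`-sub-bunches, one for each variable `x_i`. -/
def IsStandardBunch (S : Set (Arrow β)) : Prop :=
  ∃ T : Fin r → Set (Arrow β), (∀ i, β.IsStandardSubBunch i (T i)) ∧ S = ⋃ i, T i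

end BasisSet

section CoordinateRing

variable (K : Type u) [Field K] {r : ℕ} (β : BasisSet r)

/-- The monomial ideal `I_β ⊆ K[x_1, …, x_r]` generated by the monomials not in `β`. -/
noncomputable def monomialIdeal : Ideal (MvPolynomial (Fin r) K) :=
  Ideal.span {f | ∃ d : Fin r →₀ ℕ, d ∉ β.monos ∧ f = monomial d 1}

/-- The indeterminate `C^d_j` if `x^d ∉ β`; the constant `1` or `0` if `x^d ∈ β`, according to
whether `d = j`. -/
noncomputable def coeffPoly (d : Fin r →₀ ℕ) (j : β.monos) : MvPolynomial (Arrow β) K :=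
  if h : d ∈ β.monos then (if d = j then 1 else 0)
  else X { tail := d, head := j, tail_notMem := h, head_mem := j.2 }

/-- The relation `C^{d'}_{j₀} - ∑_{j ∈ β} C^d_j C^{j'}_{j₀}` with `x^{d'} = x_i x^d` and
`x^{j'} = x_i x^j`. -/
noncomputable def tau (d : Fin r →₀ ℕ) (i : Fin r) (j₀ : β.monos) : MvPolynomial (Arrow β) K :=
  coeffPoly K β (d + Finsupp.single i 1) j₀ -
    ∑ j : β.monos, coeffPoly K β d j * coeffPoly K β ((j : Fin r →₀ ℕ) + Finsupp.single i 1) j₀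

noncomputable def relationIdeal : Ideal (MvPolynomial (Arrow β) K) :=
  Ideal.span {f | ∃ d : Fin r →₀ ℕ, d ∉ β.monos ∧ ∃ i j₀, f = tau K β d i j₀}

/-- The coordinate ring `R` of the affine chart `U_β` of the Hilbert scheme of points. -/
abbrev CoordRing : Type u := MvPolynomial (Arrow β) K ⧸ relationIdeal K β

variable {β} in
/-- The coordinate function `c^d_j ∈ R` of an arrow. -/
noncomputable def arrowFn (a : Arrow β) : CoordRing K β :=
  Ideal.Quotient.mk (relationIdeal K β) (X a)

/-- The ideal of `R[x]` of the universal family over `U_β`, generated by the polynomials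
`x^d - ∑_{j ∈ β} c^d_j x^j`. -/
noncomputable def universalIdeal : Ideal (MvPolynomial (Fin r) (CoordRing K β)) :=
  Ideal.span {f | ∃ d : Fin r →₀ ℕ, f = monomial d 1 -
    ∑ j : β.monos, monomial (j : Fin r →₀ ℕ)
      (Ideal.Quotient.mk (relationIdeal K β) (coeffPoly K β d j))}

/-- `A[x]/J` is a free `A`-module with basis `β`. -/
def HasBasis {A : Type u} [CommRing A] (J : Ideal (MvPolynomial (Fin r) A)) : Prop :=
  LinearIndependent A
      (fun j : β.monos => Ideal.Quotient.mk J (monomial (j : Fin r →₀ ℕ) (1 : A))) ∧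
    Submodule.span A (Set.range
      (fun j : β.monos => Ideal.Quotient.mk J (monomial (j : Fin r →₀ ℕ) (1 : A)))) = ⊤

/-- `Spec R` with the family defined by `I ⊆ R[x]` is `U_β` with its universal family: it represents
the functor sending a `K`-algebra `A` to the set of ideals `J ⊆ A[x]` such that `A[x]/J` is free
with basis `β`. -/
def IsUniversalFamily (R : Type u) [CommRing R] [Algebra K R]
    (I : Ideal (MvPolynomial (Fin r) R)) : Prop :=
  HasBasis β I ∧
    ∀ (A : Type u) [CommRing A] [Algebra K A] (J : Ideal (MvPolynomial (Fin r) A)),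
      HasBasis β J →
        ∃! φ : R →ₐ[K] A, I.map (MvPolynomial.map (φ : R →+* A)) = J

variable {K β} in
theorem aeval_zero_coeffPoly {d : Fin r →₀ ℕ} (hd : d ∉ β.monos) (j : β.monos) :
    aeval (fun _ : Arrow β => (0 : K)) (coeffPoly K β d j) = 0 := by
  simp [coeffPoly, hd]

theorem aeval_zero_of_mem_relationIdeal (f : MvPolynomial (Arrow β) K)
    (hf : f ∈ relationIdeal K β) : aeval (fun _ : Arrow β => (0 : K)) f = 0 := by
  have h : relationIdeal K β ≤ RingHom.ker (aeval (R := K) (fun _ : Arrow β => (0 : K))) := by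
    refine Ideal.span_le.2 ?_
    rintro _ ⟨d, hd, i, j₀, rfl⟩
    have hd' : d + Finsupp.single i 1 ∉ β.monos := fun h => hd (β.mem_of_le h le_self_add)
    simp only [tau, SetLike.mem_coe, RingHom.mem_ker, map_sub, map_sum, map_mul,
      aeval_zero_coeffPoly hd, aeval_zero_coeffPoly hd', zero_mul, Finset.sum_const_zero, sub_zero]
  exact h hf

/-- The `K`-point `t_β` of `U_β = Spec R`, at which all the functions `c^d_j` vanish. -/
noncomputable def originPoint : CoordRing K β →ₐ[K] K :=
  Ideal.Quotient.liftₐ (relationIdeal K β) (aeval (fun _ : Arrow β => (0 : K)))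
    (aeval_zero_of_mem_relationIdeal K β)

/-- The maximal ideal `M ⊆ R` of the point `t_β`. -/
noncomputable def originIdeal : Ideal (CoordRing K β) := RingHom.ker (originPoint K β)

instance originIdeal_isPrime : (originIdeal K β).IsPrime :=
  RingHom.ker_isPrime (originPoint K β)

variable {β} in
theorem arrowFn_mem (a : Arrow β) : arrowFn K a ∈ originIdeal K β := by
  change originPoint K β (arrowFn K a) = 0
  simp [originPoint, arrowFn]

variable {β} in
/-- The class of the arrow `c^d_j` in the cotangent space `M/M²`. -/
noncomputable def arrowClass (a : Arrow β) : (originIdeal K β).Cotangent :=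
  (originIdeal K β).toCotangent ⟨arrowFn K a, arrowFn_mem K a⟩

/-- `t_β` is a nonsingular point: its local ring is a regular local ring. -/
def IsNonsingularPoint : Prop := IsRegularLocalRing (Localization.AtPrime (originIdeal K β))

end CoordinateRing

/-! ### Translation, exit positions and promotion of single arrows -/

namespace Arrow

variable {r : ℕ} {β : BasisSet r}

/-! Combinatorics. Translation preserves the vector head − tail, hence standardness and offset. At
every stage of promotion for fixed `i` and `v`, the heads have pairwise different `x_i`-degrees,
namely those of the monomials of `β` in the column `v`, and all arrows at or below an advanceable
one share its tail. So the arrows up to the highest advanceable one form exactly its shadow; a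
promotion exchanges this for a shadow with the same degrees and a lower tail
(`IsPromotionStage.promotionRound`). The height of the advanceable arrows drops strictly, so the
process ends. The columns together give `n` arrows for each variable, and an arrow is standard in
only one direction, whence `rn` arrows.

Independence. For an arrow that is not `∼ 0`, putting `ε` on its translation class and `0` on all
other arrows defines a deformation of `I_β` over the dual numbers (`isCoeffSystem_deformation`),
that is, a tangent vector which reads off the coefficient of that class. Final arrows are not `∼ 0`;
two equivalent ones have equal height, because neither can be advanced, and therefore coincide.

Nonsingularity. Let `P` be the kernel of the map from `R` to the coordinate ring of `n`-tuples of
points imposing independent conditions on the span of `β`. Coordinates of points are integral over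
the coefficients, so `R/P` has dimension `rn` at each closed point. Contracting a grid of points
indexed by `β` to the origin degenerates it to `I_β`, so `P ⊆ M` and `M` has height at least `rn`.
If a bunch spans `M/M²`, then `rn` elements generate the maximal ideal of `R_M`, which is therefore
regular.

Conversely, a regular local ring is a domain (`IsRegularLocalRing.isDomain`), so a single component
passes through `t_β`. It is the one of `P`, because `P` is a minimal prime: the discriminant is not
in `P`, and where it is nonzero a geometric fibre consists of `n` distinct points
(`eq_principalComponent_of_le`). Hence `R_M` has dimension `rn`, so `M/M²` has dimension at most
`rn` and `rn` independent arrows span it. -/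

theorem Step.symm {a b : Arrow β} (h : Step a b) : Step b a := by
  obtain ⟨i, h | h⟩ := h
  · exact ⟨i, Or.inr h⟩
  · exact ⟨i, Or.inl h⟩

theorem TransEquiv.symm {a b : Arrow β} (h : TransEquiv a b) : TransEquiv b a := by
  induction h with
  | refl => exact .refl
  | tail _ hs ih => exact ih.head hs.symm

theorem Step.head_add_tail {a b : Arrow β} (h : Step a b) (k : Fin r) :
    a.head k + b.tail k = b.head k + a.tail k := by
  obtain ⟨i, ⟨h₁, h₂⟩ | ⟨h₁, h₂⟩⟩ := h <;> simp only [h₁, h₂, Finsupp.add_apply] <;> omega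

theorem TransEquiv.head_add_tail {a b : Arrow β} (h : TransEquiv a b) (k : Fin r) :
    a.head k + b.tail k = b.head k + a.tail k := by
  induction h with
  | refl => rfl
  | tail _ hs ih => have := hs.head_add_tail k; omega

theorem TransEquiv.offset_eq {a b : Arrow β} (h : TransEquiv a b) (i : Fin r) :
    b.offset i = a.offset i := by
  funext k
  have := h.head_add_tail k
  simp only [offset]
  omega

theorem TransEquiv.isStandardFor {a b : Arrow β} (h : TransEquiv a b) {i : Fin r}
    (ha : a.IsStandardFor i) : b.IsStandardFor i := by
  refine ⟨?_, fun k hk => ?_⟩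
  · have := h.head_add_tail i; have := ha.1; omega
  · have := h.head_add_tail k; have := ha.2 k hk; omega

/-- The standard direction of an arrow is unique. -/
theorem IsStandardFor.unique {a : Arrow β} {i k : Fin r} (hi : a.IsStandardFor i)
    (hk : a.IsStandardFor k) : i = k := by
  by_contra h
  have := hi.1
  have := hk.2 i h
  omega

theorem offset_eq_iff {a b : Arrow β} {i : Fin r} :
    a.offset i = b.offset i ↔ ∀ k, k ≠ i → a.head k + b.tail k = b.head k + a.tail k := by
  constructor
  · intro h k hk
    have := congrFun h ⟨k, hk⟩
    simp only [offset] at this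
    omega
  · intro h
    funext k
    have := h k k.2
    simp only [offset]
    omega

theorem mem_shadow_iff {i : Fin r} {a b : Arrow β} :
    b ∈ shadow i a ↔
      b.tail = a.tail ∧ b.head i ≤ a.head i ∧ ∀ k, k ≠ i → b.head k = a.head k := by
  constructor
  · rintro ⟨h, s, hs⟩
    refine ⟨h, by simp [hs], fun k hk => ?_⟩
    simp [hs, Finsupp.single_eq_of_ne hk]
  · rintro ⟨h, h₁, h₂⟩
    refine ⟨h, a.head i - b.head i, Finsupp.ext fun k => ?_⟩
    by_cases hk : k = i
    · subst hk; simp; omega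
    · simp [Finsupp.single_eq_of_ne hk, h₂ k hk]

/-- With the offset given, the shadow is determined by the tail and the degree of the head. -/
theorem mem_shadow_of_offset_eq {i : Fin r} {a b : Arrow β} (ho : b.offset i = a.offset i)
    (ht : b.tail = a.tail) (hh : b.head i ≤ a.head i) : b ∈ shadow i a := by
  refine mem_shadow_iff.2 ⟨ht, hh, fun k hk => ?_⟩
  have := offset_eq_iff.1 ho k hk
  rw [ht] at this
  omega

theorem offset_eq_of_mem_shadow {i : Fin r} {a b : Arrow β} (h : b ∈ shadow i a) :
    b.offset i = a.offset i := by
  obtain ⟨h₁, -, h₂⟩ := mem_shadow_iff.1 h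
  exact offset_eq_iff.2 fun k hk => by rw [h₁, h₂ k hk]

theorem IsStandardFor.of_mem_shadow {i : Fin r} {a b : Arrow β} (ha : a.IsStandardFor i)
    (h : b ∈ shadow i a) : b.IsStandardFor i := by
  obtain ⟨h₁, h₂, h₃⟩ := mem_shadow_iff.1 h
  refine ⟨?_, fun k hk => ?_⟩
  · rw [h₁]; exact h₂.trans_lt ha.1
  · rw [h₁, h₃ k hk]; exact ha.2 k hk

/-- The arrow in the shadow of `a` whose head has a given smaller degree. -/
theorem exists_mem_shadow (i : Fin r) (a : Arrow β) {m : ℕ} (hm : m ≤ a.head i) :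
    ∃ b ∈ shadow i a, b.head i = m := by
  refine ⟨⟨a.tail, a.head - Finsupp.single i (a.head i - m), a.tail_notMem,
    β.mem_of_le a.head_mem tsub_le_self⟩, ⟨rfl, a.head i - m, ?_⟩, ?_⟩
  · refine (tsub_add_cancel_of_le ?_).symm
    rw [Finsupp.single_le_iff]
    omega
  · simp; omega

/-- A nonnegative offset makes an arrow standard, since its tail cannot divide its head. -/
theorem isStandardFor_of_tail_le {i : Fin r} {a : Arrow β} (h : ∀ k, k ≠ i → a.tail k ≤ a.head k) :
    a.IsStandardFor i := by
  refine ⟨?_, h⟩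
  by_contra hi
  refine a.tail_notMem (β.mem_of_le a.head_mem fun k => ?_)
  by_cases hk : k = i
  · subst hk; omega
  · exact h k hk

theorem IsFirstExit.transEquiv {i : Fin r} {a p : Arrow β} (h : IsFirstExit i a p) :
    TransEquiv a p :=
  Relation.ReflTransGen.mono (fun _ _ h => h.1) _ _ h.1

/-- Any reachable exit position is preceded by a first one. -/
theorem exists_isFirstExit_of_isExit {i : Fin r} {a p : Arrow β} (h : TransEquiv a p)
    (hp : IsExit i a p) : ∃ q, IsFirstExit i a q := by
  by_contra hne
  push Not at hne
  have key : ∀ q, TransEquiv a q →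
      Relation.ReflTransGen (fun q q' => Step q q' ∧ ¬ IsExit i a q) a q := by
    intro q hq
    induction hq with
    | refl => exact .refl
    | tail _ hs ih => exact ih.tail ⟨hs, fun he => hne _ ⟨ih, he⟩⟩
  exact hne p ⟨key p h, hp⟩

/-- A path descending below the height of its origin passes through an exit position. -/
theorem exists_isExit_of_lt {i : Fin r} {a b : Arrow β} (h : TransEquiv a b)
    (hlt : b.tail i < a.tail i) : ∃ p, TransEquiv a p ∧ IsExit i a p := by
  induction h with
  | refl => omega
  | @tail c d hc hs ih =>
    by_cases hci : c.tail i < a.tail i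
    · exact ih hci
    · obtain ⟨k, ⟨h₁, -⟩ | ⟨h₁, -⟩⟩ := hs
      · simp only [h₁, Finsupp.add_apply] at hlt
        omega
      · have hk : k = i := by
          by_contra hk
          simp [h₁, Finsupp.single_eq_of_ne' hk] at hci
          omega
        subst hk
        refine ⟨c, hc, ?_, d.tail, d.tail_notMem, h₁⟩
        simp only [h₁, Finsupp.add_apply, Finsupp.single_eq_same] at hci ⊢
        omega

theorem CanAdvance.exists_isFirstExit {i : Fin r} {a : Arrow β} (hs : a.IsStandardFor i)
    (h : a.CanAdvance i) : ∃ p, IsFirstExit i a p := by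
  obtain ⟨p, hp, hpe⟩ : ∃ p, TransEquiv a p ∧ IsExit i a p := by
    obtain ⟨b, hb, k, hk, hdrop⟩ | ⟨b, hb, hlt⟩ := h
    · by_cases hlt : b.tail i < a.tail i
      · exact exists_isExit_of_lt hb hlt
      have hbs := hb.isStandardFor hs
      -- In a direction `k ≠ i` a standard arrow has tail at most head. A head of degree zero there
      -- leaves the tail nothing to drop.
      have hki : k = i := by
        by_contra hki
        obtain ⟨m, -, hm⟩ := hdrop
        have := hbs.2 k hki
        simp [hm] at this
        omega
      subst hki
      refine ⟨b, hb, ?_, hdrop⟩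
      have := hb.head_add_tail k
      omega
    · exact exists_isExit_of_lt hb hlt
  exact exists_isFirstExit_of_isExit hp hpe

/-- Every monomial outside `β` is divisible by a minimal one. -/
theorem exists_minimal_le {d : Fin r →₀ ℕ} (hd : d ∉ β.monos) :
    ∃ b ≤ d, Minimal (fun d => d ∉ β.monos) b :=
  exists_minimal_le_of_wellFoundedLT (fun d => d ∉ β.monos) d hd

/-- The prescribed head divides the head of the exit position, so it stays in `β`. The truncated
subtractions are exact, because off `i` the new tail is at most the old tail, which is at most the
head. -/
theorem exists_promotes {i : Fin r} {a : Arrow β} (hs : a.IsStandardFor i) (h : a.CanAdvance i) :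
    ∃ c, Promotes i a c := by
  obtain ⟨p, hp⟩ := h.exists_isFirstExit hs
  have hps := hp.transEquiv.isStandardFor hs
  obtain ⟨m, hm, hpm⟩ := hp.2.2
  obtain ⟨b, hbm, hb⟩ := exists_minimal_le hm
  have hbp : b ≤ p.tail := hbm.trans (by rw [hpm]; exact le_self_add)
  let f : Fin r →₀ ℕ := Finsupp.equivFunOnFinite.symm
    fun k => if k = i then p.head i else p.head k - (p.tail k - b k)
  have hf : f ∈ β.monos := by
    refine β.mem_of_le p.head_mem fun k => ?_
    by_cases hk : k = i
    · simp [f, hk]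
    · simp [f, hk]
  refine ⟨⟨b, f, hb.prop, hf⟩, p, hp, hb, ?_, by simp [f], fun k hk => ?_⟩
  · rw [hpm]
    exact add_le_add_left hbm _
  · have := hps.2 k hk
    have := hbp k
    simp only [f, Finsupp.equivFunOnFinite_symm_apply_apply, hk, if_false]
    omega

theorem Promotes.head_eq {i : Fin r} {a c : Arrow β} (h : Promotes i a c) :
    c.head i = a.head i := by
  obtain ⟨p, hp, -, -, hc, -⟩ := h
  have := hp.transEquiv.head_add_tail i
  have := hp.2.1
  omega

theorem Promotes.tail_lt {i : Fin r} {a c : Arrow β} (h : Promotes i a c) :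
    c.tail i < a.tail i := by
  obtain ⟨p, hp, -, hle, -⟩ := h
  have := hle i
  rw [Finsupp.add_apply, Finsupp.single_eq_same] at this
  rw [← hp.2.1]
  omega

theorem Promotes.offset_eq {i : Fin r} {a c : Arrow β} (h : Promotes i a c) :
    c.offset i = a.offset i := by
  obtain ⟨p, hp, -, -, -, hc⟩ := h
  exact (offset_eq_iff.2 hc).trans (hp.transEquiv.offset_eq i)

theorem Promotes.isMinimal {i : Fin r} {a c : Arrow β} (h : Promotes i a c) : c.IsMinimal := by
  obtain ⟨p, -, hc, -⟩ := h
  exact hc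

theorem Promotes.isStandardFor {i : Fin r} {a c : Arrow β} (h : Promotes i a c)
    (ha : a.IsStandardFor i) : c.IsStandardFor i := by
  refine isStandardFor_of_tail_le fun k hk => ?_
  have := offset_eq_iff.1 h.offset_eq k hk
  have := ha.2 k hk
  omega

/-- The element of `β` above which an `x_i`-standard arrow lies: the `x_i`-degree of the head
together with the `x_i`-offset. -/
noncomputable def footprint (i : Fin r) (a : Arrow β) : Fin r →₀ ℕ :=
  Finsupp.equivFunOnFinite.symm fun k => if k = i then a.head i else a.head k - a.tail k

@[simp]
theorem footprint_self (i : Fin r) (a : Arrow β) : footprint i a i = a.head i := by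
  simp [footprint]

theorem footprint_of_ne {i k : Fin r} (hk : k ≠ i) (a : Arrow β) :
    footprint i a k = a.head k - a.tail k := by
  simp [footprint, hk]

theorem footprint_mem (i : Fin r) (a : Arrow β) : footprint i a ∈ β.monos := by
  refine β.mem_of_le a.head_mem fun k => ?_
  by_cases hk : k = i
  · simp [hk]
  · simp [footprint_of_ne hk]

end Arrow

/-! ### Iterated shadow promotion: invariants, termination, counting -/

namespace BasisSet

variable {r : ℕ} (β : BasisSet r)

/-- The monomials of `β` whose exponents in the variables other than `x_i` are given by `v`. -/
def column (i : Fin r) (v : {k : Fin r // k ≠ i} → ℤ) : Set (Fin r →₀ ℕ) :=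
  {j | j ∈ β.monos ∧ ∀ k : {k : Fin r // k ≠ i}, (j k : ℤ) = v k}

/-- What all stages of iterated shadow promotion have in common. -/
structure IsPromotionStage (i : Fin r) (v : {k : Fin r // k ≠ i} → ℤ) (T : Set (Arrow β)) :
    Prop where
  isMinimal : ∀ a ∈ T, a.IsMinimal
  isStandardFor : ∀ a ∈ T, a.IsStandardFor i
  offset_eq : ∀ a ∈ T, a.offset i = v
  injOn : ∀ a ∈ T, ∀ b ∈ T, a.head i = b.head i → a = b
  surjOn : ∀ j ∈ β.column i v, ∃ a ∈ T, a.head i = j i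
  -- Together with the common offset, this makes the arrows of `T` at or below an advanceable arrow
  -- members of its shadow.
  tail_eq : ∀ a ∈ T, a.CanAdvance i → ∀ b ∈ T, b.head i ≤ a.head i → b.tail = a.tail

variable {β} {i : Fin r} {v : {k : Fin r // k ≠ i} → ℤ} {T : Set (Arrow β)}

theorem width_notMem (β : BasisSet r) (i : Fin r) : Finsupp.single i (β.width i) ∉ β.monos := by
  refine Nat.sInf_mem (s := {w | Finsupp.single i w ∉ β.monos}) ?_
  by_contra h
  rw [Set.not_nonempty_iff_eq_empty, Set.eq_empty_iff_forall_notMem] at h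
  have hinj : Function.Injective fun w : ℕ => Finsupp.single i w := Finsupp.single_injective i
  exact Set.infinite_of_injective_forall_mem hinj (s := (β.monos : Set (Fin r →₀ ℕ)))
    (fun w => by simpa using h w) β.monos.finite_toSet

theorem minimal_width (β : BasisSet r) (i : Fin r) :
    Minimal (fun d => d ∉ β.monos) (Finsupp.single i (β.width i)) := by
  refine ⟨width_notMem β i, fun d hd hle => ?_⟩
  have hd' : d = Finsupp.single i (d i) := by
    ext k
    by_cases hk : k = i
    · subst hk; simp
    · have := hle k
      simpa [Finsupp.single_eq_of_ne hk] using this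
  rw [Finsupp.single_le_iff]
  refine Nat.sInf_le (s := {w | Finsupp.single i w ∉ β.monos}) ?_
  rw [Set.mem_ofPred_eq, ← hd']
  exact hd

theorem isPromotionStage_initialSet (i : Fin r) (v : {k : Fin r // k ≠ i} → ℤ) :
    β.IsPromotionStage i v (β.initialSet i v) where
  isMinimal a ha := by
    rw [Arrow.IsMinimal, ha.1]
    exact minimal_width β i
  isStandardFor a ha := Arrow.isStandardFor_of_tail_le fun k hk => by
    rw [ha.1, Finsupp.single_eq_of_ne hk]
    exact Nat.zero_le _
  offset_eq a ha := ha.2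
  injOn a ha b hb hab := by
    have ht : a.tail = b.tail := ha.1.trans hb.1.symm
    refine Arrow.ext ht (Finsupp.ext fun k => ?_)
    by_cases hk : k = i
    · rw [hk, hab]
    · have := Arrow.offset_eq_iff.1 (ha.2.trans hb.2.symm) k hk
      rw [ht] at this
      omega
  surjOn j hj := by
    refine ⟨⟨_, j, width_notMem β i, hj.1⟩, ⟨rfl, ?_⟩, rfl⟩
    funext k
    simp [Arrow.offset, hj.2 k, Finsupp.single_eq_of_ne k.2]
  tail_eq a ha _ b hb _ := hb.1.trans ha.1.symm

/-- Removing the shadow of `a` removes exactly the arrows with head degree at most that of `a`, and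
the shadow of `c` refills exactly these degrees. The second conclusion feeds the termination
argument: whatever can still be advanced has the tail of `c`, which is lower than that of `a`. -/
theorem IsPromotionStage.promotionRound {T' : Set (Arrow β)} (h : β.IsPromotionStage i v T)
    {a c : Arrow β} (haT : a ∈ T) (ha : a.CanAdvance i)
    (hmax : ∀ b ∈ T, b.CanAdvance i → b.head i ≤ a.head i) (hc : Arrow.Promotes i a c)
    (hT' : T' = (T \ Arrow.shadow i a) ∪ Arrow.shadow i c) :
    β.IsPromotionStage i v T' ∧ ∀ b ∈ T', b.CanAdvance i → b.tail = c.tail := by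
  have hcs := hc.isStandardFor (h.isStandardFor a haT)
  have hlow : ∀ b ∈ T, b ∉ Arrow.shadow i a → a.head i < b.head i := by
    intro b hb hba
    by_contra hle
    rw [not_lt] at hle
    exact hba (Arrow.mem_shadow_of_offset_eq ((h.offset_eq b hb).trans (h.offset_eq a haT).symm)
      (h.tail_eq a haT ha b hb hle) hle)
  have hsh : ∀ b ∈ Arrow.shadow i c, b.head i ≤ a.head i := fun b hb => by
    rw [← hc.head_eq]
    exact (Arrow.mem_shadow_iff.1 hb).2.1
  -- The surviving old arrows lie strictly above `a`, which was the highest advanceable one.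
  have hadv : ∀ b ∈ T', b.CanAdvance i → b ∈ Arrow.shadow i c := by
    intro b hb hb'
    rw [hT'] at hb
    obtain hb | hb := hb
    · exact absurd (hmax b hb.1 hb') (not_le.2 (hlow b hb.1 hb.2))
    · exact hb
  have hoff : ∀ b ∈ T', b.offset i = v := by
    rw [hT']
    rintro b (hb | hb)
    · exact h.offset_eq b hb.1
    · rw [Arrow.offset_eq_of_mem_shadow hb, hc.offset_eq, h.offset_eq a haT]
  refine ⟨⟨?_, ?_, hoff, ?_, ?_, ?_⟩, fun b hb hb' => (hadv b hb hb').1⟩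
  · rw [hT']
    rintro b (hb | hb)
    · exact h.isMinimal b hb.1
    · rw [Arrow.IsMinimal, hb.1]
      exact hc.isMinimal
  · rw [hT']
    rintro b (hb | hb)
    · exact h.isStandardFor b hb.1
    · exact hcs.of_mem_shadow hb
  · rw [hT']
    rintro b (hb | hb) b' (hb' | hb') hbb
    · exact h.injOn b hb.1 b' hb'.1 hbb
    · exact absurd (hsh b' hb') (by have := hlow b hb.1 hb.2; omega)
    · exact absurd (hsh b hb) (by have := hlow b' hb'.1 hb'.2; omega)
    · obtain ⟨h₁, -, h₂⟩ := Arrow.mem_shadow_iff.1 hb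
      obtain ⟨h₁', -, h₂'⟩ := Arrow.mem_shadow_iff.1 hb'
      refine Arrow.ext (h₁.trans h₁'.symm) (Finsupp.ext fun k => ?_)
      by_cases hk : k = i
      · rw [hk, hbb]
      · rw [h₂ k hk, h₂' k hk]
  · intro j hj
    obtain ⟨b, hb, hbj⟩ := h.surjOn j hj
    rw [hT']
    by_cases hba : b ∈ Arrow.shadow i a
    · obtain ⟨b', hb', hb'j⟩ := Arrow.exists_mem_shadow i c (m := j i)
        (by rw [hc.head_eq, ← hbj]; exact (Arrow.mem_shadow_iff.1 hba).2.1)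
      exact ⟨b', Or.inr hb', hb'j⟩
    · exact ⟨b, Or.inl ⟨hb, hba⟩, hbj⟩
  · intro b hb hb' b' hb'T hle
    have hbc := hadv b hb hb'
    rw [hT'] at hb'T
    obtain hb'T | hb'T := hb'T
    · have := hlow b' hb'T.1 hb'T.2
      have := hsh b hbc
      omega
    · exact hb'T.1.trans hbc.1.symm

theorem IsIteratedPromotion.isPromotionStage (h : β.IsIteratedPromotion i v T) :
    β.IsPromotionStage i v T := by
  obtain ⟨h, -⟩ := h
  induction h with
  | refl => exact isPromotionStage_initialSet i v
  | tail _ hr ih =>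
    obtain ⟨a, haT, ha, hmax, c, hc, hTnew⟩ := hr
    exact (ih.promotionRound haT ha hmax hc hTnew).1

/-- Iterated shadow promotion terminates, since the height of the arrows that can be advanced
drops in each round. -/
theorem IsPromotionStage.exists_final (h : β.IsPromotionStage i v T) (N : ℕ)
    (hN : ∀ a ∈ T, a.CanAdvance i → a.tail i ≤ N) :
    ∃ T', Relation.ReflTransGen (Arrow.PromotionRound i) T T' ∧ ∀ a ∈ T', ¬ a.CanAdvance i := by
  induction N generalizing T with
  | zero =>
    -- A standard arrow has positive height, so nothing can be advanced.
    refine ⟨T, .refl, fun a ha ha' => ?_⟩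
    have := hN a ha ha'
    have := (h.isStandardFor a ha).1
    omega
  | succ N ih =>
    by_cases hT : ∃ a ∈ T, a.CanAdvance i
    · obtain ⟨a, ⟨haT, ha⟩, hmax⟩ : ∃ a, (a ∈ T ∧ a.CanAdvance i) ∧
          ∀ b, b ∈ T ∧ b.CanAdvance i → b.head i ≤ a.head i := by
        have hfin : ((fun a : Arrow β => a.head i) '' {a | a ∈ T ∧ a.CanAdvance i}).Finite := by
          refine (β.monos.finite_toSet.image fun j => j i).subset ?_
          rintro _ ⟨a, -, rfl⟩
          exact ⟨a.head, a.head_mem, rfl⟩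
        obtain ⟨_, ⟨a, ha, rfl⟩, hmax⟩ := Set.exists_max_image _ id hfin (Set.Nonempty.image _ hT)
        exact ⟨a, ha, fun b hb => hmax _ ⟨b, hb, rfl⟩⟩
      obtain ⟨c, hc⟩ := Arrow.exists_promotes (h.isStandardFor a haT) ha
      have hmax' : ∀ b ∈ T, b.CanAdvance i → b.head i ≤ a.head i := fun b hb hb' => hmax b ⟨hb, hb'⟩
      obtain ⟨h', hadv⟩ := h.promotionRound haT ha hmax' hc rfl
      obtain ⟨T', hr, hT'⟩ := ih h' fun b hb hb' => by
        rw [hadv b hb hb']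
        have := hc.tail_lt
        have := hN a haT ha
        omega
      exact ⟨T', hr.head ⟨a, haT, ha, hmax', c, hc, rfl⟩, hT'⟩
    · push Not at hT
      exact ⟨T, .refl, hT⟩

theorem exists_isIteratedPromotion (β : BasisSet r) (i : Fin r) (v : {k : Fin r // k ≠ i} → ℤ) :
    ∃ T, β.IsIteratedPromotion i v T :=
  (isPromotionStage_initialSet i v).exists_final (β.width i) fun a ha _ => by simp [ha.1]

theorem exists_isStandardBunch (β : BasisSet r) : ∃ S, β.IsStandardBunch S := by
  choose T hT using β.exists_isIteratedPromotion
  exact ⟨_, _, fun i => ⟨T i, hT i, rfl⟩, rfl⟩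

/-- The arrows of an outcome of iterated promotion lie bijectively above a column of `β`. -/
theorem IsPromotionStage.footprint_bijOn (h : β.IsPromotionStage i v T) :
    Set.BijOn (Arrow.footprint i) T (β.column i v) := by
  have hmaps : Set.MapsTo (Arrow.footprint i) T (β.column i v) := fun a ha => by
    refine ⟨Arrow.footprint_mem i a, fun k => ?_⟩
    have := (h.isStandardFor a ha).2 k k.2
    rw [Arrow.footprint_of_ne k.2, ← h.offset_eq a ha, Arrow.offset]
    omega
  refine ⟨hmaps, fun a ha b hb hab => ?_, fun j hj => ?_⟩
  · refine h.injOn a ha b hb ?_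
    simpa using DFunLike.congr_fun hab i
  · obtain ⟨a, ha, haj⟩ := h.surjOn j hj
    refine ⟨a, ha, Finsupp.ext fun k => ?_⟩
    by_cases hk : k = i
    · subst hk; simpa using haj
    · have h₁ := (hmaps ha).2 ⟨k, hk⟩
      have h₂ := hj.2 ⟨k, hk⟩
      simp only at h₁ h₂
      omega

/-- The offset `v` is recovered from the footprint, so the bijections onto the columns glue to one
onto `β`. -/
theorem IsStandardSubBunch.footprint_bijOn {S : Set (Arrow β)} (h : β.IsStandardSubBunch i S) :
    Set.BijOn (Arrow.footprint i) S (β.monos : Set (Fin r →₀ ℕ)) := by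
  obtain ⟨T, hT, rfl⟩ := h
  have hst := fun v => (hT v).isPromotionStage
  refine ⟨fun a _ => Arrow.footprint_mem i a, fun a ha b hb hab => ?_, fun j hj => ?_⟩
  · obtain ⟨v, hv⟩ := Set.mem_iUnion.1 ha
    obtain ⟨w, hw⟩ := Set.mem_iUnion.1 hb
    have hvw : v = w := by
      funext k
      rw [← ((hst v).footprint_bijOn.mapsTo hv).2 k, hab,
        ((hst w).footprint_bijOn.mapsTo hw).2 k]
    subst hvw
    exact (hst v).footprint_bijOn.injOn hv hw hab
  · obtain ⟨a, ha, haj⟩ := (hst fun k => (j k : ℤ)).footprint_bijOn.surjOn ⟨hj, fun _ => rfl⟩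
    exact ⟨a, Set.mem_iUnion.2 ⟨_, ha⟩, haj⟩

theorem IsStandardSubBunch.isMinimal {S : Set (Arrow β)} (h : β.IsStandardSubBunch i S)
    {a : Arrow β} (ha : a ∈ S) : a.IsMinimal := by
  obtain ⟨T, hT, rfl⟩ := h
  obtain ⟨v, hv⟩ := Set.mem_iUnion.1 ha
  exact (hT v).isPromotionStage.isMinimal a hv

theorem IsStandardSubBunch.isStandardFor {S : Set (Arrow β)} (h : β.IsStandardSubBunch i S)
    {a : Arrow β} (ha : a ∈ S) : a.IsStandardFor i := by
  obtain ⟨T, hT, rfl⟩ := h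
  obtain ⟨v, hv⟩ := Set.mem_iUnion.1 ha
  exact (hT v).isPromotionStage.isStandardFor a hv

theorem IsStandardSubBunch.not_canAdvance {S : Set (Arrow β)} (h : β.IsStandardSubBunch i S)
    {a : Arrow β} (ha : a ∈ S) : ¬ a.CanAdvance i := by
  obtain ⟨T, hT, rfl⟩ := h
  obtain ⟨v, hv⟩ := Set.mem_iUnion.1 ha
  exact (hT v).2 a hv

theorem IsStandardBunch.isMinimal_and_isStandard {S : Set (Arrow β)} (h : β.IsStandardBunch S)
    {a : Arrow β} (ha : a ∈ S) : a.IsMinimal ∧ a.IsStandard := by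
  obtain ⟨T, hT, rfl⟩ := h
  obtain ⟨i, hi⟩ := Set.mem_iUnion.1 ha
  exact ⟨(hT i).isMinimal hi, i, (hT i).isStandardFor hi⟩

theorem IsStandardBunch.not_equivZero {S : Set (Arrow β)} (h : β.IsStandardBunch S)
    {a : Arrow β} (ha : a ∈ S) : ¬ a.EquivZero := by
  obtain ⟨T, hT, rfl⟩ := h
  obtain ⟨i, hi⟩ := Set.mem_iUnion.1 ha
  exact fun h0 => (hT i).not_canAdvance hi (Or.inl h0)

/-- Distinct arrows of a standard bunch are not translation-equivalent. -/
theorem IsStandardBunch.eq_of_transEquiv {S : Set (Arrow β)} (h : β.IsStandardBunch S)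
    {a b : Arrow β} (ha : a ∈ S) (hb : b ∈ S) (hab : a.TransEquiv b) : a = b := by
  obtain ⟨T, hT, rfl⟩ := h
  obtain ⟨i, hi⟩ := Set.mem_iUnion.1 ha
  obtain ⟨k, hk⟩ := Set.mem_iUnion.1 hb
  have hbi := hab.isStandardFor ((hT i).isStandardFor hi)
  obtain rfl := hbi.unique ((hT k).isStandardFor hk)
  -- Neither arrow can be advanced, so their heights agree. Since the vectors agree too, so do the
  -- head degrees and the footprints.
  have hlt : ¬ b.tail i < a.tail i := fun h => (hT i).not_canAdvance hi (Or.inr ⟨b, hab, h⟩)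
  have hgt : ¬ a.tail i < b.tail i := fun h => (hT i).not_canAdvance hk (Or.inr ⟨a, hab.symm, h⟩)
  refine (hT i).footprint_bijOn.injOn hi hk (Finsupp.ext fun l => ?_)
  have := hab.head_add_tail l
  by_cases hl : l = i
  · subst hl
    simp only [Arrow.footprint_self]
    omega
  · have := ((hT i).isStandardFor hi).2 l hl
    rw [Arrow.footprint_of_ne hl, Arrow.footprint_of_ne hl]
    omega

/-- A standard bunch has one arrow for each pair of a variable and a monomial of `β`. -/
theorem IsStandardBunch.exists_equiv {S : Set (Arrow β)} (h : β.IsStandardBunch S) :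
    Nonempty (S ≃ Fin r × β.monos) := by
  obtain ⟨T, hT, rfl⟩ := h
  have hdisj : Pairwise (Function.onFun Disjoint T) := fun i k hik =>
    Set.disjoint_left.2 fun a ha hk =>
      hik (((hT i).isStandardFor ha).unique ((hT k).isStandardFor hk))
  exact ⟨(Set.unionEqSigmaOfDisjoint hdisj).trans <|
    (Equiv.sigmaCongrRight fun i => (hT i).footprint_bijOn.equiv).trans <|
      Equiv.sigmaEquivProd _ _⟩

theorem IsStandardBunch.finite {S : Set (Arrow β)} (h : β.IsStandardBunch S) : S.Finite := by
  obtain ⟨e⟩ := h.exists_equiv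
  exact Finite.of_equiv _ e.symm

theorem IsStandardBunch.ncard_eq {S : Set (Arrow β)} (h : β.IsStandardBunch S) :
    S.ncard = r * β.monos.card := by
  obtain ⟨e⟩ := h.exists_equiv
  rw [← Nat.card_coe_set_eq, Nat.card_congr e]
  simp

end BasisSet

/-- Induction on exponent vectors by unit steps. -/
theorem exponent_induction {r : ℕ} {P : (Fin r →₀ ℕ) → Prop} (zero : P 0)
    (add_single : ∀ d i, P d → P (d + Finsupp.single i 1)) (d : Fin r →₀ ℕ) : P d := by
  suffices h : ∀ e, P e → P (e + d) by simpa using h 0 zero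
  induction d using Finsupp.induction_linear with
  | zero => simp
  | add f g hf hg =>
    intro e he
    rw [← add_assoc]
    exact hg _ (hf _ he)
  | single i n =>
    induction n with
    | zero => simp
    | succ n ih =>
      intro e he
      rw [Finsupp.single_add, ← add_assoc]
      exact add_single _ _ (ih e he)

theorem BasisSet.zero_mem {r : ℕ} (β : BasisSet r) : 0 ∈ β.monos := by
  obtain ⟨j, hj⟩ := β.nonempty
  exact β.mem_of_le hj zero_le

/-! ### Ideals with basis `β` and their systems of coefficients -/

section CoeffSystem

variable {r : ℕ} {β : BasisSet r} {A : Type u} [CommRing A]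

/-- The polynomial supported on `β` with given coefficients. -/
noncomputable def basisPoly (β : BasisSet r) (A : Type u) [CommRing A] :
    (β.monos → A) →ₗ[A] MvPolynomial (Fin r) A :=
  Fintype.linearCombination A fun j : β.monos => monomial (j : Fin r →₀ ℕ) (1 : A)

theorem basisPoly_apply (w : β.monos → A) :
    basisPoly β A w = ∑ j : β.monos, monomial (j : Fin r →₀ ℕ) (w j) := by
  simp [basisPoly, Fintype.linearCombination_apply, smul_monomial]

theorem hasBasis_iff {J : Ideal (MvPolynomial (Fin r) A)} :
    HasBasis β J ↔ (∀ w, basisPoly β A w ∈ J → w = 0) ∧ ∀ f, ∃ w, f - basisPoly β A w ∈ J := by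
  have key : ∀ w : β.monos → A, ∑ j : β.monos, w j • Ideal.Quotient.mk J (monomial j.1 (1 : A)) =
      Ideal.Quotient.mk J (basisPoly β A w) := fun w => by
    rw [basisPoly, Fintype.linearCombination_apply, map_sum]
    exact Finset.sum_congr rfl fun j _ => rfl
  refine and_congr ?_ ?_
  · rw [Fintype.linearIndependent_iff]
    refine forall_congr' fun w => ?_
    rw [key, Ideal.Quotient.eq_zero_iff_mem, funext_iff]
    rfl
  · rw [Submodule.eq_top_iff']
    simp only [Submodule.mem_span_range_iff_exists_fun, key]
    constructor
    · intro h f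
      obtain ⟨w, hw⟩ := h (Ideal.Quotient.mk J f)
      exact ⟨w, Ideal.Quotient.eq.1 hw.symm⟩
    · intro h f
      obtain ⟨f, rfl⟩ := Ideal.Quotient.mk_surjective f
      obtain ⟨w, hw⟩ := h f
      exact ⟨w, (Ideal.Quotient.eq.2 hw).symm⟩

/-- The coefficients `γ d j` of the monomials `x^d` in the basis `β` of a quotient of `A[x]`. -/
structure IsCoeffSystem (γ : (Fin r →₀ ℕ) → β.monos → A) : Prop where
  apply_mem : ∀ d j : β.monos, γ d j = if d = j then 1 else 0
  apply_add_single : ∀ d i j₀, γ (d + Finsupp.single i 1) j₀ =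
    ∑ j : β.monos, γ d j * γ ((j : Fin r →₀ ℕ) + Finsupp.single i 1) j₀

/-- The ideal generated by the polynomials `x^d - ∑ γ^d_j x^j`. -/
noncomputable def coeffIdeal (γ : (Fin r →₀ ℕ) → β.monos → A) : Ideal (MvPolynomial (Fin r) A) :=
  Ideal.span {f | ∃ d : Fin r →₀ ℕ, f = monomial d 1 -
    ∑ j : β.monos, monomial (j : Fin r →₀ ℕ) (γ d j)}

theorem monomial_sub_mem_coeffIdeal (γ : (Fin r →₀ ℕ) → β.monos → A) (d : Fin r →₀ ℕ) :
    monomial d 1 - basisPoly β A (γ d) ∈ coeffIdeal γ :=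
  Ideal.subset_span ⟨d, by rw [basisPoly_apply]⟩

theorem coeffIdeal_le {γ : (Fin r →₀ ℕ) → β.monos → A} {J : Ideal (MvPolynomial (Fin r) A)}
    (h : ∀ d, monomial d 1 - basisPoly β A (γ d) ∈ J) : coeffIdeal γ ≤ J := by
  refine Ideal.span_le.2 ?_
  rintro _ ⟨d, rfl⟩
  rw [← basisPoly_apply]
  exact h d

/-- The expansion of polynomials in the basis `β` given by the coefficients of monomials. -/
noncomputable def basisCoords (γ : (Fin r →₀ ℕ) → β.monos → A) :
    MvPolynomial (Fin r) A →ₗ[A] (β.monos → A) :=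
  (basisMonomials (Fin r) A).constr A γ

theorem basisCoords_monomial (γ : (Fin r →₀ ℕ) → β.monos → A) (d : Fin r →₀ ℕ) (a : A) :
    basisCoords γ (monomial d a) = a • γ d := by
  have h := (basisMonomials (Fin r) A).constr_basis A γ d
  rw [coe_basisMonomials] at h
  rw [← mul_one a, ← smul_eq_mul, ← smul_monomial, map_smul, basisCoords, h, smul_eq_mul, mul_one]

theorem sub_basisPoly_basisCoords_mem (γ : (Fin r →₀ ℕ) → β.monos → A) (f : MvPolynomial (Fin r) A) :
    f - basisPoly β A (basisCoords γ f) ∈ coeffIdeal γ := by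
  induction f using MvPolynomial.induction_on' with
  | monomial d a =>
    have h := (coeffIdeal γ).mul_mem_left (C a) (monomial_sub_mem_coeffIdeal γ d)
    rwa [mul_sub, C_mul_monomial, mul_one, ← smul_eq_C_mul, ← map_smul, ← basisCoords_monomial] at h
  | add p q hp hq =>
    have h := add_mem hp hq
    rwa [map_add, map_add, add_sub_add_comm]

namespace IsCoeffSystem

variable {γ : (Fin r →₀ ℕ) → β.monos → A}

theorem apply_coe (h : IsCoeffSystem γ) (j : β.monos) : γ j = Pi.single j 1 := by
  funext l
  rw [h.apply_mem, Pi.single_apply]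
  simp [eq_comm]

theorem basisCoords_basisPoly (h : IsCoeffSystem γ) (w : β.monos → A) :
    basisCoords γ (basisPoly β A w) = w := by
  rw [basisPoly_apply, map_sum]
  simp only [basisCoords_monomial, h.apply_coe]
  funext l
  simp [Finset.sum_apply, Pi.single_apply]

/-- The coordinates of `x_i f` depend only on those of `f`. This is what makes the kernel of the
coordinate map an ideal. -/
theorem basisCoords_X_mul (h : IsCoeffSystem γ) (i : Fin r) (f : MvPolynomial (Fin r) A) :
    basisCoords γ (X i * f) =
      ∑ j : β.monos, basisCoords γ f j • γ ((j : Fin r →₀ ℕ) + Finsupp.single i 1) := by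
  induction f using MvPolynomial.induction_on' with
  | monomial d a =>
    rw [X, monomial_mul, one_mul, basisCoords_monomial, basisCoords_monomial, add_comm]
    funext l
    simp only [Pi.smul_apply, smul_eq_mul, Finset.sum_apply]
    rw [h.apply_add_single, Finset.mul_sum]
    exact Finset.sum_congr rfl fun j _ => (mul_assoc _ _ _).symm
  | add p q hp hq =>
    rw [mul_add, map_add, hp, hq, map_add]
    simp [add_smul, Finset.sum_add_distrib]

theorem mem_coeffIdeal_iff (h : IsCoeffSystem γ) {f : MvPolynomial (Fin r) A} :
    f ∈ coeffIdeal γ ↔ basisCoords γ f = 0 := by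
  constructor
  · intro hf
    have hmul : ∀ p q : MvPolynomial (Fin r) A, basisCoords γ q = 0 → basisCoords γ (p * q) = 0 := by
      intro p q hq
      induction p using MvPolynomial.induction_on with
      | C a => rw [← smul_eq_C_mul, map_smul, hq, smul_zero]
      | add p p' hp hp' => rw [add_mul, map_add, hp, hp', add_zero]
      | mul_X p i hp => rw [mul_comm p, mul_assoc, h.basisCoords_X_mul, hp]; simp
    -- The kernel of the coordinate map, as an ideal; it contains the generators of `coeffIdeal γ`.
    let N : Ideal (MvPolynomial (Fin r) A) :=
      { (LinearMap.ker (basisCoords γ)).toAddSubmonoid with smul_mem' := fun p q hq => hmul p q hq }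
    refine coeffIdeal_le (J := N) (fun d => ?_) hf
    change basisCoords γ _ = 0
    rw [map_sub, h.basisCoords_basisPoly, basisCoords_monomial, one_smul, sub_self]
  · intro hf
    have := sub_basisPoly_basisCoords_mem γ f
    rwa [hf, map_zero, sub_zero] at this

theorem hasBasis (h : IsCoeffSystem γ) : HasBasis β (coeffIdeal γ) := by
  refine hasBasis_iff.2 ⟨fun w hw => ?_, fun f => ⟨_, sub_basisPoly_basisCoords_mem γ f⟩⟩
  rwa [h.mem_coeffIdeal_iff, h.basisCoords_basisPoly] at hw

theorem map {B : Type*} [CommRing B] (h : IsCoeffSystem γ) (φ : A →+* B) :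
    IsCoeffSystem fun d j => φ (γ d j) where
  apply_mem d j := by simp [h.apply_mem, apply_ite φ]
  apply_add_single d i j₀ := by simp [h.apply_add_single d i j₀]

end IsCoeffSystem

namespace HasBasis

variable {J : Ideal (MvPolynomial (Fin r) A)}

theorem eq_of_sub_mem (hJ : HasBasis β J) {f : MvPolynomial (Fin r) A} {w w' : β.monos → A}
    (h : f - basisPoly β A w ∈ J) (h' : f - basisPoly β A w' ∈ J) : w = w' := by
  refine sub_eq_zero.1 ((hasBasis_iff.1 hJ).1 _ ?_)
  have := sub_mem h' h
  rwa [sub_sub_sub_cancel_left, ← map_sub] at this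

/-- Expansions modulo `J` are unique. Multiplying that of `x^d` by `x_i` and expanding each `x_i
x^j` again gives an expansion of `x_i x^d`. -/
theorem isCoeffSystem (hJ : HasBasis β J) {γ : (Fin r →₀ ℕ) → β.monos → A}
    (h : ∀ d, monomial d 1 - basisPoly β A (γ d) ∈ J) : IsCoeffSystem γ where
  apply_mem d j := by
    have : γ d = Pi.single d 1 := by
      refine hJ.eq_of_sub_mem (h d) ?_
      simp [basisPoly]
    rw [this, Pi.single_apply]
    simp [eq_comm]
  apply_add_single d i j₀ := by
    have : γ (d + Finsupp.single i 1) =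
        ∑ j : β.monos, γ d j • γ ((j : Fin r →₀ ℕ) + Finsupp.single i 1) := by
      refine hJ.eq_of_sub_mem (h _) ?_
      have h₁ := J.mul_mem_left (X i) (h d)
      have h₂ : ∑ j : β.monos, C (γ d j) * (monomial ((j : Fin r →₀ ℕ) + Finsupp.single i 1) 1 -
          basisPoly β A (γ ((j : Fin r →₀ ℕ) + Finsupp.single i 1))) ∈ J :=
        sum_mem fun j _ => J.mul_mem_left _ (h _)
      have h₃ := add_mem h₁ h₂
      convert h₃ using 1
      rw [basisPoly_apply (γ d), mul_sub, X, monomial_mul, one_mul, add_comm d, Finset.mul_sum]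
      simp only [mul_sub, Finset.sum_sub_distrib, C_mul_monomial, mul_one, monomial_mul, one_mul,
        map_sum, map_smul, smul_eq_C_mul, add_comm (Finsupp.single i 1)]
      ring
    rw [this]
    simp

/-- An element of `J` reduces modulo `coeffIdeal γ ⊆ J` to a combination of `β` lying in `J`, which
is zero. -/
theorem eq_coeffIdeal (hJ : HasBasis β J) {γ : (Fin r →₀ ℕ) → β.monos → A}
    (h : ∀ d, monomial d 1 - basisPoly β A (γ d) ∈ J) : J = coeffIdeal γ := by
  refine le_antisymm (fun f hf => ?_) (coeffIdeal_le h)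
  have h₁ := sub_basisPoly_basisCoords_mem γ f
  have h₂ : basisCoords γ f = 0 := by
    refine (hasBasis_iff.1 hJ).1 _ ?_
    have := sub_mem hf (coeffIdeal_le h h₁)
    rwa [sub_sub_cancel] at this
  rwa [h₂, map_zero, sub_zero] at h₁

end HasBasis

theorem coeffIdeal_map {B : Type u} [CommRing B] (γ : (Fin r →₀ ℕ) → β.monos → A) (φ : A →+* B) :
    (coeffIdeal γ).map (MvPolynomial.map φ) = coeffIdeal fun d j => φ (γ d j) := by
  rw [coeffIdeal, Ideal.map_span, coeffIdeal]
  congr 1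
  ext f
  constructor
  · rintro ⟨_, ⟨d, rfl⟩, rfl⟩
    exact ⟨d, by simp [map_monomial]⟩
  · rintro ⟨d, rfl⟩
    exact ⟨_, ⟨d, rfl⟩, by simp [map_monomial]⟩

end CoeffSystem

/-! ### The universal property of the chart and its finite generation -/

section CoordRing

variable (K : Type u) [Field K] {r : ℕ} (β : BasisSet r)

/-- The coefficients `c^d_j ∈ R` of the universal family, for all monomials `x^d`. -/
noncomputable def universalCoeff (d : Fin r →₀ ℕ) (j : β.monos) : CoordRing K β :=
  Ideal.Quotient.mk (relationIdeal K β) (coeffPoly K β d j)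

theorem universalCoeff_arrow (a : Arrow β) :
    universalCoeff K β a.tail ⟨a.head, a.head_mem⟩ = arrowFn K a := by
  simp [universalCoeff, arrowFn, coeffPoly, a.tail_notMem]

/-- The relations `τ` give the recursion only for `x^d ∉ β`. For `x^d ∈ β` the coefficients form a
unit vector and the sum collapses to one term. -/
theorem isCoeffSystem_universalCoeff : IsCoeffSystem (universalCoeff K β) where
  apply_mem d j := by
    simp only [universalCoeff, coeffPoly, d.2, dif_pos, Subtype.coe_inj]
    split_ifs <;> simp
  apply_add_single d i j₀ := by
    by_cases hd : d ∈ β.monos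
    · rw [Finset.sum_eq_single ⟨d, hd⟩]
      · simp [universalCoeff, coeffPoly, hd]
      · intro j _ hj
        have : d ≠ j := fun h => hj (Subtype.ext h.symm)
        simp [universalCoeff, coeffPoly, hd, this]
      · simp
    · have h : tau K β d i j₀ ∈ relationIdeal K β := Ideal.subset_span ⟨d, hd, i, j₀, rfl⟩
      simpa [universalCoeff] using Ideal.Quotient.eq.2 h

theorem universalIdeal_eq : universalIdeal K β = coeffIdeal (universalCoeff K β) := rfl

variable {K β}

section Lift

variable {A : Type*} [CommRing A] [Algebra K A] {γ : (Fin r →₀ ℕ) → β.monos → A}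

theorem aeval_coeffPoly (hγ : IsCoeffSystem γ) (d : Fin r →₀ ℕ) (j : β.monos) :
    aeval (fun a : Arrow β => γ a.tail ⟨a.head, a.head_mem⟩) (coeffPoly K β d j) = γ d j := by
  by_cases hd : d ∈ β.monos
  · have := hγ.apply_mem ⟨d, hd⟩ j
    simp only at this
    rw [this]
    simp only [coeffPoly, hd, dif_pos, Subtype.ext_iff]
    split_ifs <;> simp
  · simp [coeffPoly, hd]

/-- The point of `U_β` given by a system of coefficients. -/
noncomputable def IsCoeffSystem.lift (hγ : IsCoeffSystem γ) : CoordRing K β →ₐ[K] A :=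
  Ideal.Quotient.liftₐ (relationIdeal K β)
    (aeval fun a : Arrow β => γ a.tail ⟨a.head, a.head_mem⟩) <| by
      have h : relationIdeal K β ≤ RingHom.ker
          (aeval (R := K) fun a : Arrow β => γ a.tail ⟨a.head, a.head_mem⟩) := by
        refine Ideal.span_le.2 ?_
        rintro _ ⟨d, -, i, j₀, rfl⟩
        simp only [tau, SetLike.mem_coe, RingHom.mem_ker, map_sub, map_sum, map_mul,
          aeval_coeffPoly hγ]
        rw [hγ.apply_add_single, sub_self]
      exact fun f hf => h hf

theorem IsCoeffSystem.lift_mk (hγ : IsCoeffSystem γ) (f : MvPolynomial (Arrow β) K) :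
    hγ.lift (K := K) (Ideal.Quotient.mk _ f) =
      aeval (fun a : Arrow β => γ a.tail ⟨a.head, a.head_mem⟩) f := rfl

@[simp]
theorem IsCoeffSystem.lift_universalCoeff (hγ : IsCoeffSystem γ) (d : Fin r →₀ ℕ) (j : β.monos) :
    hγ.lift (universalCoeff K β d j) = γ d j :=
  aeval_coeffPoly hγ d j

theorem CoordRing.algHom_ext {φ ψ : CoordRing K β →ₐ[K] A}
    (h : ∀ d j, φ (universalCoeff K β d j) = ψ (universalCoeff K β d j)) : φ = ψ := by
  refine Ideal.Quotient.algHom_ext _ (MvPolynomial.algHom_ext fun a => ?_)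
  have := h a.tail ⟨a.head, a.head_mem⟩
  rw [universalCoeff_arrow] at this
  exact this

end Lift

/-- Ideals with basis `β`, coefficient systems and algebra maps out of `R` are the same data:
expansions are unique, and `R` is presented by the axioms of a coefficient system. -/
theorem isUniversalFamily_universalIdeal :
    IsUniversalFamily K β (CoordRing K β) (universalIdeal K β) := by
  refine ⟨(isCoeffSystem_universalCoeff K β).hasBasis, fun A _ _ J hJ => ?_⟩
  choose γ hγ using fun d => (hasBasis_iff.1 hJ).2 (monomial d 1)
  have hs := hJ.isCoeffSystem hγ
  refine ⟨hs.lift, ?_, fun φ hφ => CoordRing.algHom_ext fun d j => ?_⟩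
  · dsimp only
    rw [universalIdeal_eq, coeffIdeal_map, hJ.eq_coeffIdeal hγ]
    congr 1
    funext d j
    exact hs.lift_universalCoeff d j
  · rw [hs.lift_universalCoeff]
    dsimp only at hφ
    rw [universalIdeal_eq, coeffIdeal_map] at hφ
    have h := monomial_sub_mem_coeffIdeal
      (fun d j => (φ : CoordRing K β →+* A) (universalCoeff K β d j)) d
    rw [hφ] at h
    exact congrFun (hJ.eq_of_sub_mem h (hγ d)) j

theorem originPoint_universalCoeff {d : Fin r →₀ ℕ} (hd : d ∉ β.monos) (j : β.monos) :
    originPoint K β (universalCoeff K β d j) = 0 :=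
  aeval_zero_coeffPoly hd j

theorem universalIdeal_map_originPoint :
    (universalIdeal K β).map (MvPolynomial.map (originPoint K β : CoordRing K β →+* K)) =
      monomialIdeal K β := by
  have hs := (isCoeffSystem_universalCoeff K β).map (originPoint K β : CoordRing K β →+* K)
  rw [universalIdeal_eq, coeffIdeal_map]
  refine le_antisymm (coeffIdeal_le fun d => ?_) (Ideal.span_le.2 ?_)
  · by_cases hd : d ∈ β.monos
    · have := hs.apply_coe ⟨d, hd⟩
      dsimp only at this
      rw [this]
      simp [basisPoly]
    · have : (fun j => (originPoint K β : CoordRing K β →+* K) (universalCoeff K β d j)) = 0 :=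
        funext fun j => originPoint_universalCoeff hd j
      rw [this, map_zero, sub_zero]
      exact Ideal.subset_span ⟨d, hd, rfl⟩
  · rintro _ ⟨d, hd, rfl⟩
    have := monomial_sub_mem_coeffIdeal
      (fun d j => (originPoint K β : CoordRing K β →+* K) (universalCoeff K β d j)) d
    have h0 : (fun j => (originPoint K β : CoordRing K β →+* K) (universalCoeff K β d j)) = 0 :=
        funext fun j => originPoint_universalCoeff hd j
    rwa [h0, map_zero, sub_zero] at this

/-- The coordinate ring is generated by the coefficients of the border monomials. -/
instance finiteType_coordRing : Algebra.FiniteType K (CoordRing K β) := by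
  classical
  let s : Set (CoordRing K β) := Set.range fun x : β.monos × Fin r × β.monos =>
    universalCoeff K β ((x.1 : Fin r →₀ ℕ) + Finsupp.single x.2.1 1) x.2.2
  have hs : s.Finite := Set.finite_range _
  have hc : ∀ d j, universalCoeff K β d j ∈ Algebra.adjoin K s := by
    intro d
    induction d using exponent_induction with
    | zero =>
      intro j
      rw [show (0 : Fin r →₀ ℕ) = (⟨0, β.zero_mem⟩ : β.monos) from rfl,
        (isCoeffSystem_universalCoeff K β).apply_mem]
      split_ifs
      exacts [one_mem _, zero_mem _]
    | add_single d i ih =>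
      intro j
      rw [(isCoeffSystem_universalCoeff K β).apply_add_single]
      exact sum_mem fun l _ => mul_mem (ih l) (Algebra.subset_adjoin ⟨(l, i, j), rfl⟩)
  refine ⟨⟨hs.toFinset, ?_⟩⟩
  rw [Set.Finite.coe_toFinset, eq_top_iff]
  rintro x -
  obtain ⟨f, rfl⟩ := Ideal.Quotient.mk_surjective x
  induction f using MvPolynomial.induction_on with
  | C a => exact Subalgebra.algebraMap_mem _ a
  | add p q hp hq => rw [map_add]; exact add_mem hp hq
  | mul_X p a hp =>
    rw [map_mul]
    refine mul_mem hp ?_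
    have := hc a.tail ⟨a.head, a.head_mem⟩
    rwa [universalCoeff_arrow] at this

end CoordRing

theorem Ideal.Cotangent.isScalarTower_self {K R : Type*} [CommSemiring K] [CommRing R]
    [Algebra K R] (I : Ideal R) : IsScalarTower K R I.Cotangent := inferInstance

/-! ### First-order deformations and independence in the cotangent space -/

section Cotangent

variable {K : Type u} [Field K] {r : ℕ} {β : BasisSet r}

instance isScalarTower_originIdeal_cotangent :
    IsScalarTower K (CoordRing K β) (originIdeal K β).Cotangent :=
  Ideal.Cotangent.isScalarTower_self _

open scoped Classical in
/-- The first-order deformation of `I_β` in the direction dual to the translation class of `a`. -/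
noncomputable def deformation (K : Type u) [Field K] (a : Arrow β) (d : Fin r →₀ ℕ)
    (j : β.monos) : DualNumber K :=
  if h : d ∈ β.monos then (if d = j then 1 else 0)
  else if a.TransEquiv ⟨d, j, h, j.2⟩ then DualNumber.eps else 0

theorem deformation_mul_deformation (a : Arrow β) {d e : Fin r →₀ ℕ} (hd : d ∉ β.monos)
    (he : e ∉ β.monos) (j l : β.monos) : deformation K a d j * deformation K a e l = 0 := by
  simp only [deformation, hd, he, dif_neg, not_false_eq_true]
  split_ifs <;> simp [DualNumber.eps_mul_eps]

/-- For `x^d ∉ β`, a product of two coefficients outside `β` contains `ε² = 0`, so only `j = j₀ -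
e_i` can contribute. The arrows `(d, j₀ - e_i)` and `(d + e_i, j₀)` differ by one step and carry the
same value. If `j₀ - e_i` does not exist, the coefficient at `(d + e_i, j₀)` must vanish; this is
where `a ≁ 0` enters. -/
theorem isCoeffSystem_deformation {a : Arrow β} (ha : ¬ a.EquivZero) :
    IsCoeffSystem (deformation K a) where
  apply_mem d j := by simp [deformation]
  apply_add_single d i j₀ := by
    by_cases hd : d ∈ β.monos
    · rw [Finset.sum_eq_single ⟨d, hd⟩]
      · simp [deformation, hd]
      · intro j _ hj
        have : d ≠ j := fun h => hj (Subtype.ext h.symm)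
        simp [deformation, hd, this]
      · simp
    have hd' : d + Finsupp.single i 1 ∉ β.monos := fun h => hd (β.mem_of_le h le_self_add)
    have hne : ∀ j : β.monos, (j : Fin r →₀ ℕ) + Finsupp.single i 1 ≠ (j₀ : Fin r →₀ ℕ) →
        deformation K a d j * deformation K a ((j : Fin r →₀ ℕ) + Finsupp.single i 1) j₀ = 0 := by
      intro j hj
      by_cases hj' : (j : Fin r →₀ ℕ) + Finsupp.single i 1 ∈ β.monos
      · have : deformation K a ((j : Fin r →₀ ℕ) + Finsupp.single i 1) j₀ = 0 := by
          simp [deformation, hj', hj]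
        rw [this, mul_zero]
      · exact deformation_mul_deformation a hd hj' _ _
    by_cases hj₀ : (j₀ : Fin r →₀ ℕ) i = 0
    · rw [Finset.sum_eq_zero fun j _ => hne j fun h => ?_]
      · rw [deformation, dif_neg hd', if_neg]
        exact fun h => ha ⟨_, h, i, hj₀, d, hd, rfl⟩
      · rw [← h] at hj₀
        simp at hj₀
    · have hle : Finsupp.single i 1 ≤ (j₀ : Fin r →₀ ℕ) := by
        rw [Finsupp.single_le_iff]
        omega
      have hadd := tsub_add_cancel_of_le hle
      let j : β.monos := ⟨(j₀ : Fin r →₀ ℕ) - Finsupp.single i 1, β.mem_of_le j₀.2 tsub_le_self⟩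
      have hj : (j : Fin r →₀ ℕ) + Finsupp.single i 1 = (j₀ : Fin r →₀ ℕ) := hadd
      rw [Finset.sum_eq_single j]
      · have h1 : deformation K a ((j : Fin r →₀ ℕ) + Finsupp.single i 1) j₀ = 1 := by
          simp [deformation, hj]
        rw [h1, mul_one, deformation, deformation, dif_neg hd', dif_neg hd]
        have hst : Arrow.Step (⟨d, j, hd, j.2⟩ : Arrow β)
            ⟨d + Finsupp.single i 1, j₀, hd', j₀.2⟩ := ⟨i, Or.inl ⟨rfl, hj.symm⟩⟩
        congr 1
        exact propext ⟨fun h => h.tail hst.symm, fun h => h.tail hst⟩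
      · intro l _ hl
        refine hne l fun h => hl (Subtype.ext ?_)
        exact add_right_cancel (h.trans hj.symm)
      · simp

theorem fst_deformation (a : Arrow β) {d : Fin r →₀ ℕ} (hd : d ∉ β.monos) (j : β.monos) :
    (deformation K a d j).fst = 0 := by
  simp only [deformation, hd, dif_neg, not_false_eq_true]
  split_ifs <;> simp

theorem fst_lift_deformation {a : Arrow β} (ha : ¬ a.EquivZero) (f : CoordRing K β) :
    ((isCoeffSystem_deformation ha).lift (K := K) f).fst = originPoint K β f := by
  have h : (TrivSqZeroExt.fstHom K K K).comp ((isCoeffSystem_deformation ha).lift (K := K)) =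
      originPoint K β := by
    refine CoordRing.algHom_ext fun d j => ?_
    rw [AlgHom.comp_apply, IsCoeffSystem.lift_universalCoeff]
    by_cases hd : d ∈ β.monos
    · have h₁ := (isCoeffSystem_deformation (K := K) ha).apply_mem ⟨d, hd⟩ j
      have h₂ := (isCoeffSystem_universalCoeff K β).apply_mem ⟨d, hd⟩ j
      dsimp only at h₁ h₂
      rw [h₁, h₂]
      split_ifs <;> simp
    · rw [originPoint_universalCoeff hd]
      exact fst_deformation a hd j
  exact DFunLike.congr_fun h f

/-- The deformation reduces to `t_β` modulo `ε`, so it sends `M` into the multiples of `ε`. -/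
theorem lift_deformation_eq_zero {a : Arrow β} (ha : ¬ a.EquivZero) {f : CoordRing K β}
    (hf : f ∈ originIdeal K β ^ 2) :
    (isCoeffSystem_deformation (K := K) ha).lift (K := K) f = 0 := by
  rw [pow_two] at hf
  refine Submodule.mul_induction_on hf (fun x hx y hy => ?_) fun x y hx hy => ?_
  · have hx' : ((isCoeffSystem_deformation (K := K) ha).lift (K := K) x).fst = (0 : K) := by
      rw [fst_lift_deformation ha]; exact hx
    have hy' : ((isCoeffSystem_deformation (K := K) ha).lift (K := K) y).fst = (0 : K) := by
      rw [fst_lift_deformation ha]; exact hy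
    rw [map_mul]
    ext <;> simp [hx', hy']
  · rw [map_add, hx, hy, add_zero]

/-- Pairwise inequivalent arrows that are not equivalent to zero are linearly independent in the
cotangent space. -/
theorem linearIndependent_arrowClass {S : Set (Arrow β)} (h0 : ∀ a ∈ S, ¬ a.EquivZero)
    (hS : ∀ a ∈ S, ∀ b ∈ S, a.TransEquiv b → a = b) :
    LinearIndependent K (fun a : S => arrowClass K (a : Arrow β)) := by
  classical
  rw [linearIndependent_iff']
  intro s g hg a ha
  have h₁ : ∑ b ∈ s, g b • arrowFn K (b : Arrow β) ∈ originIdeal K β ^ 2 := by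
    have h : (originIdeal K β).toCotangent
        (∑ b ∈ s, g b • ⟨arrowFn K (b : Arrow β), arrowFn_mem K (b : Arrow β)⟩) = 0 := by
      rw [map_sum, ← hg]
      refine Finset.sum_congr rfl fun b _ => ?_
      rw [LinearMap.map_smul_of_tower]
      rfl
    rw [Ideal.toCotangent_eq_zero] at h
    simpa using h
  have h₂ := congrArg TrivSqZeroExt.snd (lift_deformation_eq_zero (h0 a a.2) h₁)
  -- The `ε`-component of the deformation along `a` is the functional dual to `a` on the arrows of
  -- `S`.
  have h₃ : ∀ b : S, ((isCoeffSystem_deformation (h0 a a.2)).lift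
      (arrowFn K (b : Arrow β))).snd = if b = a then (1 : K) else 0 := by
    intro b
    rw [← universalCoeff_arrow, IsCoeffSystem.lift_universalCoeff, deformation,
      dif_neg b.1.tail_notMem]
    have : (a : Arrow β).TransEquiv (b : Arrow β) ↔ b = a :=
      ⟨fun h => Subtype.ext (hS a a.2 b b.2 h).symm, fun h => h ▸ .refl⟩
    change TrivSqZeroExt.snd (if (a : Arrow β).TransEquiv b then _ else _) = _
    simp only [this]
    split_ifs <;> simp
  rw [map_sum] at h₂
  simp only [map_smul, TrivSqZeroExt.snd_sum, TrivSqZeroExt.snd_smul, h₃,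
    TrivSqZeroExt.snd_zero] at h₂
  simpa [ha] using h₂

theorem BasisSet.IsStandardBunch.linearIndependent {S : Set (Arrow β)} (h : β.IsStandardBunch S) :
    LinearIndependent K (fun a : S => arrowClass K (a : Arrow β)) :=
  linearIndependent_arrowClass (fun _ ha => h.not_equivZero ha)
    fun _ ha _ hb hab => h.eq_of_transEquiv ha hb hab

end Cotangent

theorem WithBot.natCast_le_of_add_one_le {n : ℕ} {d : WithBot ℕ∞} (h : (n + 1 : WithBot ℕ∞) ≤ d + 1) :
    (n : WithBot ℕ∞) ≤ d := by
  induction d using WithBot.recBotCoe with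
  | bot =>
    rw [WithBot.bot_add, le_bot_iff] at h
    exact absurd h (by exact_mod_cast WithBot.coe_ne_bot (a := ((n + 1 : ℕ) : ℕ∞)))
  | coe d =>
    have h' : (n : ℕ∞) + 1 ≤ d + 1 := by exact_mod_cast h
    have h'' : (n : ℕ∞) ≤ d := (ENat.add_le_add_iff_right ENat.one_ne_top).1 h'
    exact_mod_cast h''

/-! ### Regular local rings are domains -/

section RegularLocalRing

open IsLocalRing

theorem exists_mem_span_eq_top (k : Type*) {V : Type*} [Field k] [AddCommGroup V] [Module k V]
    [FiniteDimensional k V] {v : V} (hv : v ≠ 0) :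
    ∃ s : Set V, s.Finite ∧ v ∈ s ∧ Submodule.span k s = ⊤ ∧ s.ncard = Module.finrank k V := by
  have hli : LinearIndepOn k id {v} := LinearIndepOn.singleton (R := k) hv
  let b := Module.Basis.extend hli
  refine ⟨_, ?_, hli.subset_extend (Set.subset_univ _) rfl, ?_, ?_⟩
  · exact Set.finite_coe_iff.1 (Module.Finite.finite_basis b)
  · rw [← b.span_eq, Module.Basis.range_extend]
  · rw [Module.finrank_eq_nat_card_basis b, Nat.card_coe_set_eq]

/-- Dividing out an element of `m \ m²` lowers the number of generators of `m`. -/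
theorem spanFinrank_maximalIdeal_quotient_lt {R : Type u} [CommRing R] [IsLocalRing R]
    [IsNoetherianRing R] {x : R} (hx : x ∈ maximalIdeal R) (hx2 : x ∉ maximalIdeal R ^ 2)
    [IsLocalRing (R ⧸ Ideal.span {x})] :
    (maximalIdeal (R ⧸ Ideal.span {x})).spanFinrank < (maximalIdeal R).spanFinrank := by
  classical
  have hv : (maximalIdeal R).toCotangent ⟨x, hx⟩ ≠ 0 := by
    rwa [Ne, Ideal.toCotangent_eq_zero]
  obtain ⟨s, hs, hvs, hspan, hcard⟩ := exists_mem_span_eq_top (ResidueField R) hv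
  choose y hy using fun l : (s \ {(maximalIdeal R).toCotangent ⟨x, hx⟩} : Set (CotangentSpace R)) =>
    (maximalIdeal R).toCotangent_surjective l
  have hspan : Submodule.span R (insert ⟨x, hx⟩ (Set.range y)) = ⊤ := by
    -- Nakayama: lifts of a spanning set of the cotangent space generate the maximal ideal.
    rw [← CotangentSpace.span_image_eq_top_iff, ← hspan]
    congr 1
    rw [Set.image_insert_eq, ← Set.range_comp]
    ext z
    constructor
    · rintro (rfl | ⟨l, rfl⟩)
      · exact hvs
      · rw [Function.comp_apply, hy l]
        exact l.2.1
    · intro hz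
      by_cases hzv : z = (maximalIdeal R).toCotangent ⟨x, hx⟩
      · exact Or.inl hzv
      · exact Or.inr ⟨⟨z, hz, hzv⟩, hy _⟩
  have hmap : maximalIdeal (R ⧸ Ideal.span {x}) =
      Ideal.span (Set.range fun l => Ideal.Quotient.mk (Ideal.span {x}) (y l : R)) := by
    have h₁ : maximalIdeal R = Ideal.span (insert x (Set.range fun l => (y l : R))) := by
      have := congrArg (Submodule.map (maximalIdeal R).subtype) hspan
      rw [Submodule.map_span, Submodule.map_top, Submodule.range_subtype, Set.image_insert_eq,
        ← Set.range_comp] at this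
      exact this.symm
    have h₂ : (maximalIdeal R).map (Ideal.Quotient.mk (Ideal.span {x})) =
        maximalIdeal (R ⧸ Ideal.span {x}) := by
      have hmax : ((maximalIdeal R).map (Ideal.Quotient.mk (Ideal.span {x}))).IsMaximal := by
        refine Ideal.IsMaximal.map_of_surjective_of_ker_le Ideal.Quotient.mk_surjective ?_
        rw [Ideal.mk_ker, Ideal.span_singleton_le_iff_mem]
        exact hx
      exact IsLocalRing.eq_maximalIdeal hmax
    rw [← h₂]
    conv_lhs => rw [h₁]
    rw [Ideal.map_span, Set.image_insert_eq,
      Ideal.Quotient.eq_zero_iff_mem.2 (Ideal.mem_span_singleton_self x), Ideal.span_insert_zero,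
      ← Set.range_comp]
    rfl
  have hlt : (s \ {(maximalIdeal R).toCotangent ⟨x, hx⟩}).ncard < s.ncard :=
    Set.ncard_sdiff_singleton_lt_of_mem hvs hs
  rw [hmap, spanFinrank_maximalIdeal_eq_finrank_cotangentSpace (R := R)]
  refine ((Submodule.spanFinrank_span_le_ncard_of_finite ?_).trans ?_).trans_lt (hlt.trans_eq hcard)
  · have := (hs.sdiff (t := {(maximalIdeal R).toCotangent ⟨x, hx⟩})).to_subtype
    exact Set.finite_range _
  · rw [← Nat.card_coe_set_eq, ← Nat.card_coe_set_eq]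
    have := (hs.sdiff (t := {(maximalIdeal R).toCotangent ⟨x, hx⟩})).to_subtype
    exact Finite.card_range_le _

/-- A regular local ring is a domain. -/
theorem IsRegularLocalRing.isDomain (R : Type u) [CommRing R] [IsRegularLocalRing R] :
    IsDomain R := by
  obtain ⟨n, hn⟩ : ∃ n, (maximalIdeal R).spanFinrank ≤ n := ⟨_, le_rfl⟩
  induction n generalizing R with
  | zero =>
    rw [Nat.le_zero, Submodule.spanFinrank_eq_zero_iff_eq_bot
      (maximalIdeal R).fg_of_isNoetherianRing] at hn
    exact (IsLocalRing.isField_iff_maximalIdeal_eq.2 hn).isDomain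
  | succ n ih =>
    by_cases h0 : maximalIdeal R = ⊥
    · exact (IsLocalRing.isField_iff_maximalIdeal_eq.2 h0).isDomain
    have hdim := (isRegularLocalRing_iff R).1 ‹_›
    have hfg := (maximalIdeal R).fg_of_isNoetherianRing
    have hpos : (maximalIdeal R).spanFinrank ≠ 0 := fun h =>
      h0 ((Submodule.spanFinrank_eq_zero_iff_eq_bot hfg).1 h)
    have hjac : maximalIdeal R ≤ (⊥ : Ideal R).jacobson :=
      (IsLocalRing.jacobson_eq_maximalIdeal ⊥ bot_ne_top).ge
    obtain ⟨x, hx, hx2, hxp⟩ : ∃ x ∈ maximalIdeal R, x ∉ maximalIdeal R ^ 2 ∧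
        ∀ p ∈ minimalPrimes R, x ∉ p := by
      by_contra! hcon
      have hsub : (maximalIdeal R : Set R) ⊆
          ⋃ p ∈ insert (maximalIdeal R ^ 2) (minimalPrimes R), (id p : Ideal R) := by
        intro x hx
        simp only [Set.mem_iUnion]
        by_cases hx2 : x ∈ maximalIdeal R ^ 2
        · exact ⟨_, Set.mem_insert _ _, hx2⟩
        · obtain ⟨p, hp, hxp⟩ := hcon x hx hx2
          exact ⟨p, Set.mem_insert_of_mem _ hp, hxp⟩
      -- Prime avoidance: `m²` is the only ideal in the list not known to be prime, and it fills
      -- both admitted exceptions. If `m ⊆ m²`, then `m = 0` by Nakayama; if `m` lies in a minimal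
      -- prime, the dimension is zero.
      rw [Ideal.subset_union_prime_finite
        ((minimalPrimes.finite_of_isNoetherianRing R).insert _) (maximalIdeal R ^ 2)
        (maximalIdeal R ^ 2)] at hsub
      · obtain ⟨p, rfl | hp, hle⟩ := hsub
        · refine h0 (Submodule.eq_bot_of_le_smul_of_le_jacobson_bot _ _ hfg ?_ hjac)
          rwa [id, pow_two] at hle
        · have := Ideal.IsMinimalPrime.isPrime hp
          have hpm : p = maximalIdeal R :=
            ((IsLocalRing.le_maximalIdeal this.ne_top).antisymm hle)
          rw [hpm] at hp
          have hh := Ideal.height_eq_zero_iff.2 hp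
          rw [← IsLocalRing.maximalIdeal_height_eq_ringKrullDim, hh] at hdim
          exact hpos (by exact_mod_cast hdim)
      · rintro p (rfl | hp) h₁ _
        · exact absurd rfl h₁
        · exact Ideal.IsMinimalPrime.isPrime hp
    have hne : Ideal.span {x} ≠ ⊤ := fun h => by
      have := Ideal.span_le.2 (Set.singleton_subset_iff.2 hx)
      rw [h, top_le_iff] at this
      exact Ideal.IsPrime.ne_top' this
    have : Nontrivial (R ⧸ Ideal.span {x}) := Ideal.Quotient.nontrivial_iff.2 hne
    have : IsLocalRing (R ⧸ Ideal.span {x}) :=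
      IsLocalRing.of_surjective' (Ideal.Quotient.mk _) Ideal.Quotient.mk_surjective
    have hlt := spanFinrank_maximalIdeal_quotient_lt hx hx2
    have hreg : IsRegularLocalRing (R ⧸ Ideal.span {x}) := by
      -- Dividing by `x` lowers the number of generators by at least one and the dimension by at
      -- most one.
      refine IsRegularLocalRing.of_spanFinrank_maximalIdeal_le _ ?_
      have h₁ := ringKrullDim_le_ringKrullDim_quotient_add_card {x} (by
        simp only [Finset.coe_singleton, Set.singleton_subset_iff, SetLike.mem_coe]
        rw [← Ideal.jacobson_bot]
        exact hjac hx)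
      rw [← hdim, Finset.coe_singleton, Finset.card_singleton] at h₁
      have h₂ : ((maximalIdeal (R ⧸ Ideal.span {x})).spanFinrank + 1 : WithBot ℕ∞) ≤
          (maximalIdeal R).spanFinrank := by exact_mod_cast hlt
      have h₃ := h₂.trans h₁
      exact WithBot.natCast_le_of_add_one_le h₃
    have hdom := ih (R ⧸ Ideal.span {x}) (by omega)
    have hprime : (Ideal.span {x}).IsPrime := (Ideal.Quotient.isDomain_iff_prime _).1 hdom
    obtain ⟨p, hp, hle⟩ := Ideal.exists_minimalPrimes_le (bot_le : ⊥ ≤ Ideal.span {x})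
    have hpp := Ideal.IsMinimalPrime.isPrime hp
    -- An element of `p ⊆ (x)` is `x z`, and `x ∉ p` forces `z ∈ p`. Thus `p ⊆ m p`, and Nakayama
    -- applies.
    have hpbot : p = ⊥ := by
      refine Submodule.eq_bot_of_le_smul_of_le_jacobson_bot (maximalIdeal R) p
        p.fg_of_isNoetherianRing (fun y hy => ?_) hjac
      obtain ⟨z, rfl⟩ := Ideal.mem_span_singleton.1 (hle hy)
      exact Ideal.mul_mem_mul hx ((hpp.mem_or_mem hy).resolve_left (hxp p hp))
    rw [hpbot] at hpp
    exact IsDomain.of_bot_isPrime R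

end RegularLocalRing

/-! ### Heights of maximal ideals and their behaviour in quotients -/

section Height

/-- Polynomial rings over a field are Jacobson, so a maximal ideal contracts to a maximal ideal in
one variable fewer, and its height exceeds that of the contraction by one. -/
theorem MvPolynomial.height_eq_of_isMaximal {K : Type u} [Field K] (s : ℕ)
    (M : Ideal (MvPolynomial (Fin s) K)) [hM : M.IsMaximal] : M.height = s := by
  induction s with
  | zero =>
    have : M.height ≤ (0 : ℕ) := by
      have h := Ideal.height_le_ringKrullDim_of_ne_top hM.ne_top
      rw [MvPolynomial.ringKrullDim_of_isNoetherianRing, ringKrullDim_eq_zero_of_field] at h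
      simpa using h
    simpa using this
  | succ s ih =>
    let e := (finSuccEquiv K s).toRingEquiv
    let N : Ideal (Polynomial (MvPolynomial (Fin s) K)) := M.map e
    have hN : N.IsMaximal := Ideal.map_isMaximal_of_equiv e
    have hu : (N.under (MvPolynomial (Fin s) K)).IsMaximal :=
      Polynomial.isMaximal_comap_C_of_isJacobsonRing N
    have hlo : N.LiesOver (N.under (MvPolynomial (Fin s) K)) := ⟨rfl⟩
    have h := Polynomial.height_eq_height_add_one (N.under (MvPolynomial (Fin s) K)) N
    rw [ih] at h
    rw [← e.height_map M]
    exact_mod_cast h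

/-- The height of a maximal ideal of a domain that is integral over a polynomial ring. -/
theorem Ideal.height_eq_of_isIntegral {K D : Type u} [Field K] [CommRing D] [IsDomain D]
    [IsNoetherianRing D] [Algebra K D] {s : ℕ} (g : MvPolynomial (Fin s) K →ₐ[K] D)
    (hg : Function.Injective g) (hgi : g.IsIntegral) (M : Ideal D) [M.IsMaximal] :
    M.height = s := by
  algebraize [g.toRingHom]
  have : Algebra.IsIntegral (MvPolynomial (Fin s) K) D := ⟨hgi⟩
  have : FaithfulSMul (MvPolynomial (Fin s) K) D :=
    (faithfulSMul_iff_algebraMap_injective _ _).2 hg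
  have : (M.under (MvPolynomial (Fin s) K)).IsMaximal :=
    Ideal.isMaximal_comap_of_isIntegral_of_isMaximal M
  rw [← MvPolynomial.height_eq_of_isMaximal s (M.under (MvPolynomial (Fin s) K))]
  refine le_antisymm ?_ ?_
  · have hmono : StrictMono (PrimeSpectrum.comap (algebraMap (MvPolynomial (Fin s) K) D)) :=
      fun p q hpq => Ideal.IsIntegral.comap_lt_comap hpq
    have h := Order.height_le_height_apply_of_strictMono _ hmono ⟨M, inferInstance⟩
    rw [← PrimeSpectrum.height_eq_orderHeight, ← PrimeSpectrum.height_eq_orderHeight] at h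
    exact h
  · rw [Ideal.height_eq_height_add_of_liesOver_of_hasGoingDown
      (M.under (MvPolynomial (Fin s) K)) M]
    exact le_self_add

variable {R : Type u} [CommRing R]

theorem Ideal.height_map_quotient_le {P M : Ideal R} [M.IsPrime] (hPM : P ≤ M) :
    (M.map (Ideal.Quotient.mk P)).height ≤ M.height := by
  have : (M.map (Ideal.Quotient.mk P)).IsPrime :=
    Ideal.map_isPrime_of_surjective Ideal.Quotient.mk_surjective (by rwa [Ideal.mk_ker])
  have h := Order.height_le_height_apply_of_strictMono _
    (RingHom.strictMono_comap_of_surjective (Ideal.Quotient.mk_surjective (I := P)))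
    ⟨M.map (Ideal.Quotient.mk P), this⟩
  rw [← PrimeSpectrum.height_eq_orderHeight, ← PrimeSpectrum.height_eq_orderHeight] at h
  refine h.trans_eq ?_
  congr 1
  rw [PrimeSpectrum.comap_asIdeal,
    Ideal.comap_map_of_surjective' _ Ideal.Quotient.mk_surjective, Ideal.mk_ker,
    sup_eq_left.2 hPM]

/-- Every prime inside `M` contains `Q`, so chains of primes below `M` survive in the quotient. -/
theorem Ideal.height_le_height_map_quotient [IsNoetherianRing R] {Q M : Ideal R} [M.IsPrime]
    (hQ : ∀ p : Ideal R, p.IsPrime → p ≤ M → Q ≤ p) :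
    M.height ≤ (M.map (Ideal.Quotient.mk Q)).height := by
  have hprime : ∀ p : Ideal R, p.IsPrime → p ≤ M → (p.map (Ideal.Quotient.mk Q)).IsPrime :=
    fun p hp hpM => Ideal.map_isPrime_of_surjective Ideal.Quotient.mk_surjective
      (by rw [Ideal.mk_ker]; exact hQ p hp hpM)
  have hmono : ∀ q p : Ideal R, q.IsPrime → p.IsPrime → q < p → p ≤ M →
      q.map (Ideal.Quotient.mk Q) < p.map (Ideal.Quotient.mk Q) := by
    intro q p hq hp hqp hpM
    refine (Ideal.map_mono hqp.le).lt_of_ne fun he => hqp.ne ?_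
    have := congrArg (Ideal.comap (Ideal.Quotient.mk Q)) he
    rwa [Ideal.comap_map_of_surjective' _ Ideal.Quotient.mk_surjective,
      Ideal.comap_map_of_surjective' _ Ideal.Quotient.mk_surjective, Ideal.mk_ker,
      sup_eq_left.2 (hQ p hp hpM), sup_eq_left.2 (hQ q hq (hqp.le.trans hpM))] at this
  suffices h : ∀ n : ℕ, ∀ p : Ideal R, p.IsPrime → p ≤ M →
      (p.map (Ideal.Quotient.mk Q)).height ≤ n → p.height ≤ n by
    have := hprime M ‹_› le_rfl
    obtain ⟨n, hn⟩ := ENat.ne_top_iff_exists.1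
      (Ideal.height_ne_top_of_isPrime (I := M.map (Ideal.Quotient.mk Q)))
    rw [← hn]
    exact h n M ‹_› le_rfl hn.symm.le
  intro n
  induction n with
  | zero =>
    intro p hp hpM h
    have := hprime p hp hpM
    rw [Ideal.height_le_iff] at h ⊢
    intro q hq hqp
    refine absurd (h _ (hprime q hq (hqp.le.trans hpM)) (hmono q p hq hp hqp hpM))
      (by simp)
  | succ n ih =>
    intro p hp hpM h
    have := hprime p hp hpM
    rw [Ideal.height_le_iff] at h ⊢
    intro q hq hqp
    have hlt := h _ (hprime q hq (hqp.le.trans hpM)) (hmono q p hq hp hqp hpM)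
    have h₁ := ih q hq (hqp.le.trans hpM) (by
      rw [Nat.cast_add, Nat.cast_one] at hlt
      exact Order.lt_add_one_iff_of_not_isMax (by simp) |>.1 hlt)
    refine h₁.trans_lt ?_
    exact_mod_cast Nat.lt_succ_self n

end Height

/-! ### Generators of the maximal ideal of `R_M` versus spanning sets of `M/M²` -/

section LocalCotangent

open IsLocalRing

variable {K R : Type u} [Field K] [CommRing R] [Algebra K R] [IsNoetherianRing R]
  {M : Ideal R} [M.IsPrime]

/-- Elements spanning `M/M²` generate the maximal ideal of the local ring at `M`. -/
theorem spanFinrank_maximalIdeal_le_of_span_eq_top {s : Set M} (hs : s.Finite)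
    (hspan : Submodule.span K (M.toCotangent '' s) = ⊤) :
    (maximalIdeal (Localization.AtPrime M)).spanFinrank ≤ s.ncard := by
  have hspanR : Submodule.span R (M.toCotangent '' s) = ⊤ := by
    have := Ideal.Cotangent.isScalarTower_self (K := K) M
    rw [eq_top_iff]
    intro x _
    have hx : x ∈ Submodule.span K (M.toCotangent '' s) := hspan ▸ Submodule.mem_top
    exact Submodule.span_subset_span K R _ hx
  -- Localizing this inclusion gives the hypothesis of Nakayama's lemma in `R_M`.
  have hM : M ≤ Ideal.span ((↑) '' s) ⊔ M * M := by
    intro x hx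
    have h : M.toCotangent ⟨x, hx⟩ ∈ Submodule.map M.toCotangent (Submodule.span R s) := by
      rw [Submodule.map_span, hspanR]
      exact Submodule.mem_top
    obtain ⟨y, hy, hxy⟩ := h
    rw [eq_comm, Ideal.toCotangent_eq, pow_two] at hxy
    have hy' : (y : R) ∈ Ideal.span ((↑) '' s : Set R) := by
      have := Submodule.mem_map_of_mem (f := M.subtype) hy
      rwa [Submodule.map_span] at this
    exact Submodule.mem_sup.2 ⟨y, hy', _, hxy, add_sub_cancel _ _⟩
  let L := Localization.AtPrime M
  have hmap := Ideal.map_mono (f := algebraMap R L) hM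
  rw [Ideal.map_sup, Ideal.map_mul, Localization.AtPrime.map_eq_maximalIdeal, Ideal.map_span,
    Set.image_image] at hmap
  have hle : maximalIdeal L ≤ Ideal.span ((fun y : M => algebraMap R L y) '' s) :=
    Submodule.le_of_le_smul_of_le_jacobson_bot (maximalIdeal L).fg_of_isNoetherianRing
      (IsLocalRing.jacobson_eq_maximalIdeal ⊥ bot_ne_top).ge hmap
  have heq : maximalIdeal L = Ideal.span ((fun y : M => algebraMap R L y) '' s) := by
    refine le_antisymm hle (Ideal.span_le.2 ?_)
    rintro _ ⟨y, -, rfl⟩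
    rw [← Localization.AtPrime.map_eq_maximalIdeal]
    exact Ideal.mem_map_of_mem _ y.2
  change (maximalIdeal L).spanFinrank ≤ _
  rw [heq]
  exact (Submodule.spanFinrank_span_le_ncard_of_finite (hs.image _)).trans
    (Set.ncard_image_le hs)

/-- At a rational point, generators of the maximal ideal of the local ring span `M/M²`. -/
theorem exists_span_cotangent_eq_top (hres : ∀ f : R, ∃ c : K, f - algebraMap K R c ∈ M) :
    ∃ t : Set M.Cotangent, t.Finite ∧
      t.ncard ≤ (maximalIdeal (Localization.AtPrime M)).spanFinrank ∧
      Submodule.span K t = ⊤ := by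
  let L := Localization.AtPrime M
  have htower := Ideal.Cotangent.isScalarTower_self (K := K) M
  have hfg : (maximalIdeal L).FG := (maximalIdeal L).fg_of_isNoetherianRing
  have hgfin : (maximalIdeal L).generators.Finite := Submodule.FG.finite_generators hfg
  -- Clearing denominators replaces each generator by an element of `M`, up to a unit.
  have hg : ∀ g : (maximalIdeal L).generators, ∃ a : M, ∃ u : R, u ∉ M ∧
      (g : L) * algebraMap R L u = algebraMap R L a := by
    intro g
    obtain ⟨⟨a, u⟩, h⟩ := IsLocalization.surj M.primeCompl (g : L)
    have hgm : (g : L) ∈ maximalIdeal L := by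
      have h := Submodule.subset_span (R := L) g.2
      rwa [Submodule.span_generators] at h
    have ha : a ∈ M := by
      rw [← IsLocalization.AtPrime.to_map_mem_maximal_iff L M, ← h]
      exact Ideal.mul_mem_right _ _ hgm
    exact ⟨⟨a, ha⟩, u, u.2, h⟩
  choose a u hu hau using hg
  -- The point is rational, so `R` acts on `M/M²` through the scalars `f(t) ∈ K`; elements outside
  -- `M` act invertibly.
  have hsmul : ∀ (f : R) (x : M.Cotangent), ∃ c : K, f • x = c • x ∧ (f ∉ M → c ≠ 0) := by
    intro f x
    obtain ⟨c, hc⟩ := hres f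
    refine ⟨c, ?_, fun hf h0 => hf ?_⟩
    · have := Ideal.Cotangent.smul_eq_zero_of_mem hc x
      rwa [sub_smul, algebraMap_smul, sub_eq_zero] at this
    · rwa [h0, map_zero, sub_zero] at hc
  have := hgfin.to_subtype
  have := Fintype.ofFinite (maximalIdeal L).generators
  refine ⟨Set.range fun g => M.toCotangent (a g), Set.finite_range _, ?_, ?_⟩
  · rw [← Submodule.FG.generators_ncard hfg, ← Nat.card_coe_set_eq, ← Nat.card_coe_set_eq]
    exact Finite.card_range_le _
  rw [eq_top_iff]
  rintro x -
  obtain ⟨x, rfl⟩ := M.toCotangent_surjective x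
  have hle : maximalIdeal L ≤ (Ideal.span (Set.range fun g => (a g : R))).map (algebraMap R L) := by
    conv_lhs => rw [← Submodule.span_generators (maximalIdeal L)]
    refine Submodule.span_le.2 fun g hg => ?_
    have hunit := IsLocalization.map_units L (⟨u ⟨g, hg⟩, hu ⟨g, hg⟩⟩ : M.primeCompl)
    have h := hau ⟨g, hg⟩
    refine (Ideal.mul_unit_mem_iff_mem _ hunit).1 ?_
    rw [h]
    exact Ideal.mem_map_of_mem _ (Ideal.subset_span ⟨_, rfl⟩)
  have hx : algebraMap R L x ∈ (Ideal.span (Set.range fun g => (a g : R))).map (algebraMap R L) :=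
    hle (by rw [← Localization.AtPrime.map_eq_maximalIdeal]; exact Ideal.mem_map_of_mem _ x.2)
  obtain ⟨v, hv, hvx⟩ := (IsLocalization.algebraMap_mem_map_algebraMap_iff M.primeCompl L _ _).1 hx
  obtain ⟨b, hb⟩ := (Submodule.mem_span_range_iff_exists_fun R).1 hvx
  have hsum : v • x = ∑ g, b g • a g := Subtype.ext (by simpa using hb.symm)
  have hcot : v • M.toCotangent x = ∑ g, b g • M.toCotangent (a g) := by
    rw [← map_smul, hsum, map_sum]
    simp
  obtain ⟨c, hc, hc0⟩ := hsmul v (M.toCotangent x)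
  have hmem : c • M.toCotangent x ∈
      Submodule.span K (Set.range fun g => M.toCotangent (a g)) := by
    rw [← hc, hcot]
    refine sum_mem fun g _ => ?_
    obtain ⟨e, he, -⟩ := hsmul (b g) (M.toCotangent (a g))
    rw [he]
    exact Submodule.smul_mem _ _ (Submodule.subset_span ⟨g, rfl⟩)
  exact (Submodule.smul_mem_iff _ (hc0 hv)).1 hmem

end LocalCotangent

/-! ### Families of points, their coefficients and the discriminant -/

section Points

variable {r : ℕ} {β : BasisSet r} {A : Type*} [CommRing A]

/-- The value of the monomial `x^d` at a point. -/
def monomialValue (q : Fin r → A) (d : Fin r →₀ ℕ) : A := ∏ i, q i ^ d i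

theorem monomialValue_zero (q : Fin r → A) : monomialValue q 0 = 1 := by
  simp [monomialValue]

theorem monomialValue_add (q : Fin r → A) (d e : Fin r →₀ ℕ) :
    monomialValue q (d + e) = monomialValue q d * monomialValue q e := by
  simp [monomialValue, pow_add, Finset.prod_mul_distrib]

theorem monomialValue_single (q : Fin r → A) (i : Fin r) :
    monomialValue q (Finsupp.single i 1) = q i := by
  rw [monomialValue, Finset.prod_eq_single i]
  · simp
  · intro k _ hk
    simp [Finsupp.single_eq_of_ne hk]
  · simp

theorem map_monomialValue {B : Type*} [CommRing B] (φ : A →+* B) (q : Fin r → A)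
    (d : Fin r →₀ ℕ) : φ (monomialValue q d) = monomialValue (fun i => φ (q i)) d := by
  simp [monomialValue]

/-- The matrix of the values of the monomials of `β` at points indexed by `β`. -/
def valueMatrix (q : β.monos → Fin r → A) : Matrix β.monos β.monos A :=
  Matrix.of fun j p => monomialValue (q p) (j : Fin r →₀ ℕ)

theorem map_det_valueMatrix {B : Type*} [CommRing B] (φ : A →+* B) (q : β.monos → Fin r → A) :
    φ (valueMatrix q).det = (valueMatrix fun p i => φ (q p i)).det := by
  rw [RingHom.map_det]
  congr 1
  ext j p
  simp [valueMatrix, map_monomialValue]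

/-- The polynomials `x^d - ∑ γ^d_j x^j` vanish at the given points. -/
def VanishesAt (γ : (Fin r →₀ ℕ) → β.monos → A) (q : β.monos → Fin r → A) : Prop :=
  ∀ d p, ∑ j : β.monos, γ d j * monomialValue (q p) (j : Fin r →₀ ℕ) = monomialValue (q p) d

theorem VanishesAt.vecMul_eq {γ : (Fin r →₀ ℕ) → β.monos → A} {q : β.monos → Fin r → A}
    (h : VanishesAt γ q) (d : Fin r →₀ ℕ) :
    Matrix.vecMul (γ d) (valueMatrix q) = fun p => monomialValue (q p) d :=
  funext fun p => h d p

theorem VanishesAt.map {B : Type*} [CommRing B] {γ : (Fin r →₀ ℕ) → β.monos → A}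
    {q : β.monos → Fin r → A} (h : VanishesAt γ q) (φ : A →+* B) :
    VanishesAt (fun d j => φ (γ d j)) fun p i => φ (q p i) := by
  intro d p
  simp only [← map_monomialValue, ← h d p, map_sum, map_mul]

section Independent

variable {q : β.monos → Fin r → A}

theorem vecMul_valueMatrix_injective (hq : IsUnit (valueMatrix q).det) :
    Function.Injective fun w => Matrix.vecMul w (valueMatrix q) :=
  Matrix.vecMul_injective_of_isUnit ((Matrix.isUnit_iff_isUnit_det _).2 hq)

theorem VanishesAt.unique (hq : IsUnit (valueMatrix q).det)
    {γ γ' : (Fin r →₀ ℕ) → β.monos → A} (h : VanishesAt γ q) (h' : VanishesAt γ' q) : γ = γ' :=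
  funext fun d => vecMul_valueMatrix_injective hq ((h.vecMul_eq d).trans (h'.vecMul_eq d).symm)

/-- Coefficient vectors are determined by their values at the points, where the recursion is just
multiplicativity of monomials. -/
theorem VanishesAt.isCoeffSystem (hq : IsUnit (valueMatrix q).det)
    {γ : (Fin r →₀ ℕ) → β.monos → A} (h : VanishesAt γ q) :
    IsCoeffSystem γ where
  apply_mem d j := by
    have : γ d = Pi.single d 1 := by
      refine vecMul_valueMatrix_injective hq ((h.vecMul_eq d).trans (funext fun p => ?_))
      simp [valueMatrix]
    rw [this, Pi.single_apply]
    simp [eq_comm]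
  apply_add_single d i j₀ := by
    have : γ (d + Finsupp.single i 1) =
        fun l => ∑ j : β.monos, γ d j * γ ((j : Fin r →₀ ℕ) + Finsupp.single i 1) l := by
      refine vecMul_valueMatrix_injective hq ((h.vecMul_eq _).trans (funext fun p => ?_))
      simp only [Matrix.vecMul, dotProduct, valueMatrix, Matrix.of_apply, Finset.sum_mul]
      rw [Finset.sum_comm, monomialValue_add, ← h d p, Finset.sum_mul]
      refine Finset.sum_congr rfl fun j _ => ?_
      rw [mul_assoc, ← monomialValue_add, ← h, Finset.mul_sum]
      exact Finset.sum_congr rfl fun l _ => (mul_assoc _ _ _).symm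
    exact congrFun this j₀

/-- The coefficients of the monomials in the basis `β` of the functions on the given points. -/
noncomputable def pointCoeff (q : β.monos → Fin r → A) (d : Fin r →₀ ℕ) : β.monos → A :=
  Matrix.vecMul (fun p => monomialValue (q p) d) (valueMatrix q)⁻¹

theorem vanishesAt_pointCoeff (hq : IsUnit (valueMatrix q).det) : VanishesAt (pointCoeff q) q := by
  intro d p
  have : Matrix.vecMul (pointCoeff q d) (valueMatrix q) = fun p => monomialValue (q p) d := by
    rw [pointCoeff, Matrix.vecMul_vecMul, Matrix.nonsing_inv_mul _ hq, Matrix.vecMul_one]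
  exact congrFun this p

end Independent

/-- The discriminant of the algebra with basis `β` defined by a system of coefficients. -/
noncomputable def coeffDiscr (γ : (Fin r →₀ ℕ) → β.monos → A) : A :=
  (Matrix.of fun j j' : β.monos => ∑ l : β.monos, γ (j + j' + l) l).det

theorem map_coeffDiscr {B : Type*} [CommRing B] (φ : A →+* B) (γ : (Fin r →₀ ℕ) → β.monos → A) :
    φ (coeffDiscr γ) = coeffDiscr fun d j => φ (γ d j) := by
  rw [coeffDiscr, RingHom.map_det]
  congr 1
  ext j p
  simp

/-- The matrix `V` of values diagonalizes multiplication by `x^d`, with the values of `x^d` as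
eigenvalues. The trace is their sum, so the matrix of the trace form is `V Vᵀ`. -/
theorem VanishesAt.coeffDiscr_eq {γ : (Fin r →₀ ℕ) → β.monos → A} {q : β.monos → Fin r → A}
    (hq : IsUnit (valueMatrix q).det) (h : VanishesAt γ q) :
    coeffDiscr γ = (valueMatrix q).det ^ 2 := by
  have htr : ∀ d, ∑ l : β.monos, γ (d + l) l = ∑ p, monomialValue (q p) d := by
    intro d
    let Γ : Matrix β.monos β.monos A := Matrix.of fun l m => γ (d + l) m
    have hΓ : Γ * valueMatrix q =
        valueMatrix q * Matrix.diagonal fun p => monomialValue (q p) d := by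
      ext l p
      rw [Matrix.mul_diagonal]
      simp only [Matrix.mul_apply, Γ, Matrix.of_apply, valueMatrix]
      rw [h, monomialValue_add, mul_comm]
    have hΓ' : Γ = valueMatrix q * (Matrix.diagonal fun p => monomialValue (q p) d) *
        (valueMatrix q)⁻¹ := by
      rw [← hΓ, Matrix.mul_assoc, Matrix.mul_nonsing_inv _ hq, Matrix.mul_one]
    have : Γ.trace = ∑ p, monomialValue (q p) d := by
      rw [hΓ', Matrix.trace_mul_cycle, Matrix.nonsing_inv_mul _ hq, Matrix.one_mul,
        Matrix.trace_diagonal]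
    rw [← this]
    rfl
  rw [coeffDiscr, pow_two]
  conv_rhs => rw [← Matrix.det_transpose (valueMatrix q)]
  conv_rhs => rw [Matrix.det_transpose]; arg 2; rw [← Matrix.det_transpose]
  rw [← Matrix.det_mul]
  congr 1
  ext j j'
  simp only [Matrix.of_apply, htr, Matrix.mul_apply, Matrix.transpose_apply, valueMatrix,
    monomialValue_add]

end Points

/-! ### Newton interpolation on the grid of points indexed by `β` -/

section Newton

variable {K : Type u} [Field K] {r : ℕ} {β : BasisSet r} (α : ℕ → K)

/-- The point of the grid `α(ℕ)^r` with given indices. -/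
def gridPoint (p : β.monos) (i : Fin r) : K := α ((p : Fin r →₀ ℕ) i)

/-- The values at the grid points of the monomial `x^d`. -/
def gridMonomial (β : BasisSet r) (d : Fin r →₀ ℕ) (p : β.monos) : K :=
  monomialValue (gridPoint α p) d

/-- The values at the grid points of the polynomial `∏_i ∏_{s < d_i} (x_i - α_s)`. -/
def gridNewton (β : BasisSet r) (d : Fin r →₀ ℕ) (p : β.monos) : K :=
  ∏ i, ∏ s ∈ Finset.range (d i), (gridPoint α p i - α s)

theorem gridMonomial_add_single (d : Fin r →₀ ℕ) (i : Fin r) (p : β.monos) :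
    gridMonomial α β (d + Finsupp.single i 1) p = gridPoint α p i * gridMonomial α β d p := by
  rw [gridMonomial, monomialValue_add, monomialValue_single, mul_comm, gridMonomial]

theorem gridNewton_add_single (d : Fin r →₀ ℕ) (i : Fin r) (p : β.monos) :
    gridNewton α β (d + Finsupp.single i 1) p =
      (gridPoint α p i - α (d i)) * gridNewton α β d p := by
  rw [gridNewton, gridNewton, ← Finset.mul_prod_erase _ _ (Finset.mem_univ i),
    ← Finset.mul_prod_erase (a := i) Finset.univ (fun i => ∏ s ∈ Finset.range (d i), _)
      (Finset.mem_univ i), ← mul_assoc]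
  congr 1
  · simp [Finset.prod_range_succ, mul_comm]
  · refine Finset.prod_congr rfl fun k hk => ?_
    simp [Finsupp.single_eq_of_ne (Finset.ne_of_mem_erase hk)]

theorem gridNewton_eq_zero {d : Fin r →₀ ℕ} {p : β.monos} (h : ¬ d ≤ p) :
    gridNewton α β d p = 0 := by
  obtain ⟨i, hi⟩ : ∃ i, (p : Fin r →₀ ℕ) i < d i := by
    by_contra! hcon
    exact h hcon
  exact Finset.prod_eq_zero (Finset.mem_univ i)
    (Finset.prod_eq_zero (Finset.mem_range.2 hi) (sub_self _))

theorem gridNewton_self_ne_zero (hα : Function.Injective α) (p : β.monos) :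
    gridNewton α β p p ≠ 0 := by
  refine Finset.prod_ne_zero_iff.2 fun i _ => Finset.prod_ne_zero_iff.2 fun s hs => ?_
  rw [sub_ne_zero]
  exact hα.ne (Finset.mem_range.1 hs).ne'

/-- With `N_e` the Newton polynomial, `x_i N_e = N_{e+e_i} + α_{e_i} N_e`, so the change of basis is
triangular for divisibility. The next lemma is its inverse. -/
theorem gridMonomial_mem_span_gridNewton (d : Fin r →₀ ℕ) :
    gridMonomial α β d ∈ Submodule.span K (gridNewton α β '' Set.Iic d) := by
  induction d using exponent_induction with
  | zero =>
    refine Submodule.subset_span ⟨0, Set.mem_Iic.2 le_rfl, funext fun p => ?_⟩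
    simp [gridNewton, gridMonomial, monomialValue_zero]
  | add_single d i ih =>
    have hmul : gridMonomial α β (d + Finsupp.single i 1) =
        LinearMap.mulLeft K (fun p => gridPoint α p i) (gridMonomial α β d) :=
      funext fun p => gridMonomial_add_single α d i p
    rw [hmul]
    refine Submodule.span_induction ?_ (by simp) (fun x y _ _ hx hy => ?_)
      (fun a x _ hx => ?_) ih
    · rintro _ ⟨e, he, rfl⟩
      have : LinearMap.mulLeft K (fun p => gridPoint α p i) (gridNewton α β e) =
          gridNewton α β (e + Finsupp.single i 1) + α (e i) • gridNewton α β e := by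
        funext p
        simp only [Pi.add_apply, Pi.smul_apply, gridNewton_add_single, LinearMap.mulLeft_apply,
          Pi.mul_apply, smul_eq_mul]
        ring
      rw [this]
      exact add_mem (Submodule.subset_span ⟨_, add_le_add_left (Set.mem_Iic.1 he) _, rfl⟩)
        (Submodule.smul_mem _ _ (Submodule.subset_span
          ⟨_, (Set.mem_Iic.1 he).trans le_self_add, rfl⟩))
    · rw [map_add]; exact add_mem hx hy
    · rw [map_smul]; exact Submodule.smul_mem _ _ hx

theorem gridNewton_mem_span_gridMonomial (d : Fin r →₀ ℕ) :
    gridNewton α β d ∈ Submodule.span K (gridMonomial α β '' Set.Iic d) := by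
  induction d using exponent_induction with
  | zero =>
    refine Submodule.subset_span ⟨0, Set.mem_Iic.2 le_rfl, funext fun p => ?_⟩
    simp [gridNewton, gridMonomial, monomialValue_zero]
  | add_single d i ih =>
    have hmul : gridNewton α β (d + Finsupp.single i 1) =
        LinearMap.mulLeft K (fun p => gridPoint α p i - α (d i)) (gridNewton α β d) :=
      funext fun p => gridNewton_add_single α d i p
    rw [hmul]
    refine Submodule.span_induction ?_ (by simp) (fun x y _ _ hx hy => ?_)
      (fun a x _ hx => ?_) ih
    · rintro _ ⟨e, he, rfl⟩
      have : LinearMap.mulLeft K (fun p => gridPoint α p i - α (d i)) (gridMonomial α β e) =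
          gridMonomial α β (e + Finsupp.single i 1) - α (d i) • gridMonomial α β e := by
        funext p
        simp only [Pi.sub_apply, Pi.smul_apply, gridMonomial_add_single, LinearMap.mulLeft_apply,
          Pi.mul_apply, smul_eq_mul]
        ring
      rw [this]
      exact sub_mem (Submodule.subset_span ⟨_, add_le_add_left (Set.mem_Iic.1 he) _, rfl⟩)
        (Submodule.smul_mem _ _ (Submodule.subset_span
          ⟨_, (Set.mem_Iic.1 he).trans le_self_add, rfl⟩))
    · rw [map_add]; exact add_mem hx hy
    · rw [map_smul]; exact Submodule.smul_mem _ _ hx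

/-- On the grid points over `β`, a monomial is a combination of its divisors in `β`. -/
theorem gridMonomial_mem_span (d : Fin r →₀ ℕ) :
    gridMonomial α β d ∈
      Submodule.span K (gridMonomial α β '' {j | j ∈ β.monos ∧ j ≤ d}) := by
  refine Submodule.span_le.2 ?_ (gridMonomial_mem_span_gridNewton α d)
  rintro _ ⟨e, he, rfl⟩
  by_cases heβ : e ∈ β.monos
  · refine Submodule.span_mono (Set.image_mono ?_) (gridNewton_mem_span_gridMonomial α e)
    exact fun j hj => ⟨β.mem_of_le heβ hj, le_trans (Set.mem_Iic.1 hj) he⟩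
  · have : gridNewton α β e = 0 :=
      funext fun p => gridNewton_eq_zero α fun h => heβ (β.mem_of_le p.2 h)
    rw [this]
    exact zero_mem _

/-- A relation `v` between the points kills every Newton polynomial indexed by `β`. At a maximal `p`
with `v p ≠ 0`, the polynomial `N_p` vanishes at every grid point not above `p`, so only the nonzero
term `N_p(p) v p` would remain. -/
theorem det_valueMatrix_gridPoint_ne_zero (hα : Function.Injective α) :
    (valueMatrix (β := β) (gridPoint α)).det ≠ 0 := by
  intro h0
  obtain ⟨v, hv0, hv⟩ := Matrix.exists_mulVec_eq_zero_iff.2 h0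
  let ℓ : (β.monos → K) →ₗ[K] K := Fintype.linearCombination K v
  have hℓ : ∀ f, ℓ f = ∑ p, f p * v p := fun f => Fintype.linearCombination_apply K v f
  have hN : ∀ e : β.monos, ∑ p, gridNewton α β (e : Fin r →₀ ℕ) p * v p = 0 := by
    intro e
    have hle : Submodule.span K (gridMonomial α β '' Set.Iic (e : Fin r →₀ ℕ)) ≤
        LinearMap.ker ℓ := by
      refine Submodule.span_le.2 ?_
      rintro _ ⟨j, hj, rfl⟩
      rw [SetLike.mem_coe, LinearMap.mem_ker, hℓ]
      exact congrFun hv ⟨j, β.mem_of_le e.2 (Set.mem_Iic.1 hj)⟩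
    rw [← hℓ]
    exact hle (gridNewton_mem_span_gridMonomial α (e : Fin r →₀ ℕ))
  obtain ⟨p, hp, hmax⟩ : ∃ p : β.monos, v p ≠ 0 ∧ ∀ q : β.monos, p < q → v q = 0 := by
    obtain ⟨p, hp⟩ := (Set.toFinite {p | v p ≠ 0}).exists_maximal (Function.ne_iff.1 hv0)
    exact ⟨p, hp.1, fun q hpq => by_contra fun hq => hp.not_gt hq hpq⟩
  have := hN p
  rw [Finset.sum_eq_single p] at this
  · exact (mul_ne_zero (gridNewton_self_ne_zero α hα p) hp) this
  · intro q _ hqp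
    by_cases hle : p ≤ q
    · rw [hmax q (lt_of_le_of_ne hle hqp.symm), mul_zero]
    · rw [gridNewton_eq_zero α hle, zero_mul]
  · simp

theorem isUnit_det_gridPoint (hα : Function.Injective α) :
    IsUnit (valueMatrix (β := β) (gridPoint α)).det :=
  (det_valueMatrix_gridPoint_ne_zero α hα).isUnit

/-- Only divisors of `x^d` occur in its expansion. Hence the exponents `deg d - deg j` in the
contraction of the grid are nonnegative. -/
theorem pointCoeff_gridPoint_eq_zero (hα : Function.Injective α) {d : Fin r →₀ ℕ} {j : β.monos}
    (h : ¬ (j : Fin r →₀ ℕ) ≤ d) : pointCoeff (β := β) (gridPoint α) d j = 0 := by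
  have hq := isUnit_det_gridPoint (β := β) α hα
  let ℓ : (β.monos → K) →ₗ[K] K :=
    (LinearMap.proj j).comp (Matrix.vecMulLinear (valueMatrix (β := β) (gridPoint α))⁻¹)
  have hle : Submodule.span K (gridMonomial α β '' {j | j ∈ β.monos ∧ j ≤ d}) ≤
      LinearMap.ker ℓ := by
    refine Submodule.span_le.2 ?_
    rintro _ ⟨l, ⟨hl, hld⟩, rfl⟩
    have := ((vanishesAt_pointCoeff hq).isCoeffSystem hq).apply_mem ⟨l, hl⟩ j
    rw [if_neg fun h' : ⟨l, hl⟩ = j => h (h' ▸ hld)] at this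
    exact this
  exact hle (gridMonomial_mem_span (β := β) α d)

end Newton

/-! ### The principal component and its passage through `t_β` -/

section PrincipalComponent

variable (K : Type u) [Field K] {r : ℕ} (β : BasisSet r)

/-- The determinant of the values of the monomials of `β` at points with indeterminate
coordinates. -/
noncomputable def genericDet : MvPolynomial (β.monos × Fin r) K :=
  (valueMatrix fun (p : β.monos) (i : Fin r) => X (p, i)).det

variable {K β} in
theorem aeval_genericDet {L : Type*} [CommRing L] [Algebra K L] (q : β.monos → Fin r → L) :
    aeval (fun x : β.monos × Fin r => q x.1 x.2) (genericDet K β) = (valueMatrix q).det := by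
  have h := map_det_valueMatrix
    (aeval (R := K) (fun x : β.monos × Fin r => q x.1 x.2)).toRingHom
    fun (p : β.monos) (i : Fin r) => X (p, i)
  simp only [AlgHom.toRingHom_eq_coe, RingHom.coe_coe, aeval_X] at h
  exact h

/-- The coordinate ring of the space of points, indexed by `β`, that impose independent conditions
on the span of `β`. -/
abbrev GenericRing : Type u := Localization.Away (genericDet K β)

/-- The universal family of such points. -/
noncomputable def indetPoint (p : β.monos) (i : Fin r) : GenericRing K β :=
  algebraMap (MvPolynomial (β.monos × Fin r) K) _ (X (p, i))

theorem det_indetPoint :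
    (valueMatrix (indetPoint K β)).det = algebraMap _ (GenericRing K β) (genericDet K β) :=
  (map_det_valueMatrix _ _).symm

theorem isUnit_det_indetPoint : IsUnit (valueMatrix (indetPoint K β)).det := by
  rw [det_indetPoint]
  exact IsLocalization.Away.algebraMap_isUnit _

/-- The morphism to `U_β` sending a family of points to the ideal of polynomials vanishing
there. -/
noncomputable def genericMap : CoordRing K β →ₐ[K] GenericRing K β :=
  ((vanishesAt_pointCoeff (isUnit_det_indetPoint K β)).isCoeffSystem
    (isUnit_det_indetPoint K β)).lift

theorem genericMap_universalCoeff (d : Fin r →₀ ℕ) (j : β.monos) :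
    genericMap K β (universalCoeff K β d j) = pointCoeff (indetPoint K β) d j :=
  IsCoeffSystem.lift_universalCoeff _ d j

theorem vanishesAt_genericMap :
    VanishesAt (fun d j => genericMap K β (universalCoeff K β d j)) (indetPoint K β) := by
  intro d p
  simp only [genericMap_universalCoeff]
  exact vanishesAt_pointCoeff (isUnit_det_indetPoint K β) d p

/-- The ideal of the closure of the locus in `U_β` of reduced families of points. -/
noncomputable def principalComponent : Ideal (CoordRing K β) := RingHom.ker (genericMap K β)

variable {K β}

/-- Every family of points with independent conditions lies on the principal component. -/
theorem principalComponent_le_ker {L : Type*} [CommRing L] [Algebra K L]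
    {q : β.monos → Fin r → L} (hq : IsUnit (valueMatrix q).det) (ψ : CoordRing K β →ₐ[K] L)
    (h : VanishesAt (fun d j => ψ (universalCoeff K β d j)) q) :
    principalComponent K β ≤ RingHom.ker ψ := by
  -- Specializing the indeterminate points to `q` extends to the localization. Composed with
  -- `genericMap` it is `ψ`, as points determine their coefficients.
  let ev : MvPolynomial (β.monos × Fin r) K →ₐ[K] L := aeval fun x => q x.1 x.2
  have hev : ev (genericDet K β) = (valueMatrix q).det := aeval_genericDet q
  have hunit : ∀ y : Submonoid.powers (genericDet K β), IsUnit (ev y) := by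
    rintro ⟨_, n, rfl⟩
    simpa [hev] using hq.pow n
  let σ : GenericRing K β →ₐ[K] L := IsLocalization.liftAlgHom hunit
  have hσ : ∀ f, σ (algebraMap _ _ f) = ev f := fun f => IsLocalization.lift_eq _ f
  have hσq : (fun p i => (σ : GenericRing K β →+* L) (indetPoint K β p i)) = q := by
    funext p i
    change σ (algebraMap _ _ (X (p, i))) = _
    rw [hσ]
    simp [ev]
  have hcomp : σ.comp (genericMap K β) = ψ := by
    refine CoordRing.algHom_ext fun d j => ?_
    have h' := (vanishesAt_genericMap K β).map (σ : GenericRing K β →+* L)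
    rw [hσq] at h'
    exact congrFun (congrFun (h'.unique hq h) d) j
  intro f hf
  rw [RingHom.mem_ker, ← hcomp, AlgHom.comp_apply]
  have hf' : genericMap K β f = 0 := hf
  rw [hf', map_zero]

section Infinite

variable [Infinite K]

theorem genericDet_ne_zero : genericDet K β ≠ 0 := by
  intro h
  let α := Infinite.natEmbedding K
  have h' := aeval_genericDet (K := K) (gridPoint (β := β) α)
  rw [h, map_zero] at h'
  exact det_valueMatrix_gridPoint_ne_zero α α.injective h'.symm

instance isDomain_genericRing : IsDomain (GenericRing K β) :=
  IsLocalization.isDomain_localization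
    (powers_le_nonZeroDivisors_of_noZeroDivisors genericDet_ne_zero)

instance isPrime_principalComponent : (principalComponent K β).IsPrime :=
  RingHom.ker_isPrime (genericMap K β)

/-- The monomial ideal is a limit of reduced families: contract the grid over `β` to the
origin. -/
theorem principalComponent_le_originIdeal : principalComponent K β ≤ originIdeal K β := by
  intro f hf
  obtain ⟨F, rfl⟩ := Ideal.Quotient.mk_surjective f
  let α := Infinite.natEmbedding K
  have hα := isUnit_det_gridPoint (β := β) α α.injective
  let γ : (Fin r →₀ ℕ) → β.monos → K := pointCoeff (gridPoint α)
  let deg : (Fin r →₀ ℕ) → ℕ := fun d => ∑ i, d i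
  have hγ : ∀ d j, γ d j ≠ 0 → (j : Fin r →₀ ℕ) ≤ d := fun d j h => by
    by_contra hle
    exact h (pointCoeff_gridPoint_eq_zero α α.injective hle)
  -- `F` along the grid scaled by the parameter: the coefficients become `γ^d_j c^{deg d - deg j}`.
  -- For `c ≠ 0` this is a family of points, so `G` vanishes there; its value at `0` is that of `F`
  -- at `t_β`.
  let G : Polynomial K := aeval (fun a : Arrow β =>
    Polynomial.C (γ a.tail ⟨a.head, a.head_mem⟩) * Polynomial.X ^ (deg a.tail - deg a.head)) F
  have hG : ∀ c : K, G.eval c = aeval (fun a : Arrow β =>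
      γ a.tail ⟨a.head, a.head_mem⟩ * c ^ (deg a.tail - deg a.head)) F := by
    intro c
    have : ((Polynomial.aeval c).comp (aeval (R := K) fun a : Arrow β =>
        Polynomial.C (γ a.tail ⟨a.head, a.head_mem⟩) *
          Polynomial.X ^ (deg a.tail - deg a.head))) = aeval (fun a : Arrow β =>
            γ a.tail ⟨a.head, a.head_mem⟩ * c ^ (deg a.tail - deg a.head)) := by
      refine MvPolynomial.algHom_ext fun a => ?_
      simp
    rw [← this, AlgHom.comp_apply, Polynomial.coe_aeval_eq_eval]
  have hroot : ∀ c : K, c ≠ 0 → G.IsRoot c := by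
    intro c hc
    let q : β.monos → Fin r → K := fun p i => c * gridPoint α p i
    have hval : ∀ p d, monomialValue (q p) d = c ^ deg d * monomialValue (gridPoint α p) d := by
      intro p d
      simp [monomialValue, q, deg, mul_pow, Finset.prod_mul_distrib, Finset.prod_pow_eq_pow_sum]
    have hq : IsUnit (valueMatrix q).det := by
      have : valueMatrix q = Matrix.of fun j p : β.monos =>
          c ^ deg j * valueMatrix (gridPoint α) j p := by
        ext j p
        exact hval p j
      rw [this, Matrix.det_mul_column, isUnit_iff_ne_zero]
      exact mul_ne_zero (Finset.prod_ne_zero_iff.2 fun j _ => pow_ne_zero _ hc) hα.ne_zero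
    have hvan : VanishesAt (fun d (j : β.monos) => γ d j * c ^ (deg d - deg j)) q := by
      intro d p
      rw [hval, ← vanishesAt_pointCoeff hα d p, Finset.mul_sum]
      refine Finset.sum_congr rfl fun j _ => ?_
      change γ d j * _ * _ = _ * (γ d j * _)
      by_cases h0 : γ d j = 0
      · simp [h0]
      · have hle : deg j ≤ deg d := Finset.sum_le_sum fun i _ => hγ d j h0 i
        rw [hval, ← Nat.sub_add_cancel hle, pow_add, Nat.sub_add_cancel hle]
        ring
    have hs := hvan.isCoeffSystem hq
    have hker := principalComponent_le_ker hq (hs.lift (K := K)) (by simpa using hvan) hf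
    rw [RingHom.mem_ker, IsCoeffSystem.lift_mk] at hker
    rw [Polynomial.IsRoot.def, hG]
    exact hker
  have hG0 : G = 0 := by
    refine Polynomial.eq_zero_of_infinite_isRoot _ ?_
    exact (Set.finite_singleton (0 : K)).infinite_compl.mono fun c hc => hroot c hc
  have h0 := hG 0
  rw [hG0, Polynomial.eval_zero] at h0
  change originPoint K β _ = 0
  have hzero : (fun a : Arrow β => γ a.tail ⟨a.head, a.head_mem⟩ *
      (0 : K) ^ (deg a.tail - deg a.head)) = fun _ => 0 := by
    funext a
    by_cases hγ0 : γ a.tail ⟨a.head, a.head_mem⟩ = 0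
    · rw [hγ0, zero_mul]
    · have hle : a.head ≤ a.tail := hγ _ _ hγ0
      -- A head dividing the tail is a proper divisor, so the exponent is positive and the
      -- coefficient vanishes at `c = 0`.
      have hlt : deg a.head < deg a.tail := by
        refine Finset.sum_lt_sum (fun i _ => hle i) ?_
        by_contra! hcon
        have : a.tail ≤ a.head := fun i => hcon i (Finset.mem_univ i)
        exact a.tail_notMem (β.mem_of_le a.head_mem this)
      rw [zero_pow (by omega), mul_zero]
  rw [hzero] at h0
  exact h0.symm

end Infinite

end PrincipalComponent

/-! ### Finite reduced algebras over an algebraically closed field -/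

section Characters

/-- For nilpotent `x` all products `x y` are nilpotent and have trace zero, so the coordinates of
`x` are killed by the trace matrix. -/
theorem isReduced_of_traceMatrix_det_ne_zero {L B ι : Type*} [Field L] [CommRing B]
    [Algebra L B] [Fintype ι] [DecidableEq ι] (b : Module.Basis ι L B) (hb : (Algebra.traceMatrix L b).det ≠ 0) : IsReduced B := by
  refine ⟨fun x hx => ?_⟩
  have htr : ∀ y : B, Algebra.trace L B (x * y) = 0 := fun y =>
    (Algebra.isNilpotent_trace_of_isNilpotent ((Commute.all x y).isNilpotent_mul_right hx)).eq_zero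
  by_contra hx0
  refine hb (Matrix.exists_vecMul_eq_zero_iff.1 ⟨b.equivFun x, ?_, ?_⟩)
  · simpa using hx0
  · funext j
    have := htr (b j)
    rw [← b.sum_equivFun x, Finset.sum_mul, map_sum] at this
    simpa [Matrix.vecMul, dotProduct, Algebra.traceMatrix_apply, Algebra.traceForm_apply] using this

variable {L : Type u} [Field L] [IsAlgClosed L] {B : Type u} [CommRing B] [Algebra L B]
  [Module.Finite L B]

/-- A finite algebra over an algebraically closed field that has no nilpotents embeds into the
functions on its characters. -/
theorem eq_zero_of_forall_algHom_eq_zero [IsReduced B] {x : B} (h : ∀ χ : B →ₐ[L] L, χ x = 0) :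
    x = 0 := by
  have : IsArtinianRing B := IsArtinianRing.of_finite L B
  have hx : x ∈ (⊥ : Ideal B).jacobson := by
    refine Ideal.mem_sInf.2 ?_
    rintro m ⟨-, hm⟩
    let := Ideal.Quotient.field m
    have : Algebra.IsAlgebraic L (B ⧸ m) := Algebra.IsAlgebraic.of_finite L (B ⧸ m)
    let ι : B ⧸ m →ₐ[L] L := IsAlgClosed.lift
    have h0 := h (ι.comp (Ideal.Quotient.mkₐ L m))
    rw [AlgHom.comp_apply] at h0
    have h1 := (map_eq_zero_iff ι ι.toRingHom.injective).1 h0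
    exact Ideal.Quotient.eq_zero_iff_mem.1 h1
  rw [IsArtinianRing.jacobson_eq_radical] at hx
  exact IsReduced.eq_zero x hx

/-- Characters are linearly independent, so there are at most `dim B` of them; since `B` embeds into
the functions on them, there are at least as many. -/
theorem exists_equiv_algHom [IsReduced B] {ι : Type*} [Fintype ι] (b : Module.Basis ι L B) :
    Nonempty (ι ≃ (B →ₐ[L] L)) := by
  have hli := linearIndependent_toLinearMap L B L
  have hfin : Finite (B →ₐ[L] L) := hli.finite
  have := Fintype.ofFinite (B →ₐ[L] L)
  have h₁ : Fintype.card (B →ₐ[L] L) ≤ Module.finrank L B := by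
    have := hli.fintype_card_le_finrank
    rwa [Module.finrank_linearMap_self] at this
  have h₂ : Module.finrank L B ≤ Fintype.card (B →ₐ[L] L) := by
    let f : B →ₗ[L] ((B →ₐ[L] L) → L) := LinearMap.pi fun χ => χ.toLinearMap
    have hf : Function.Injective f := by
      rw [← LinearMap.ker_eq_bot, LinearMap.ker_eq_bot']
      exact fun x hx => eq_zero_of_forall_algHom_eq_zero fun χ => congrFun hx χ
    have := LinearMap.finrank_le_finrank_of_injective hf
    rwa [Module.finrank_fintype_fun_eq_card] at this
  refine ⟨Fintype.equivOfCardEq ?_⟩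
  rw [← Module.finrank_eq_card_basis b]
  omega

end Characters

/-! ### Nonzero discriminant means distinct points -/

section Reduced

variable {L : Type u} [Field L] [IsAlgClosed L] {r : ℕ} {β : BasisSet r}

/-- Over an algebraically closed field, a family with nonzero discriminant is the ideal of a set
of points. -/
theorem IsCoeffSystem.exists_points {γ : (Fin r →₀ ℕ) → β.monos → L} (hγ : IsCoeffSystem γ)
    (hdisc : coeffDiscr γ ≠ 0) :
    ∃ q : β.monos → Fin r → L, IsUnit (valueMatrix q).det ∧ VanishesAt γ q := by
  let B := MvPolynomial (Fin r) L ⧸ coeffIdeal γ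
  let b : Module.Basis β.monos L B := Module.Basis.mk hγ.hasBasis.1 hγ.hasBasis.2.ge
  have hb : ∀ j, b j = Ideal.Quotient.mk (coeffIdeal γ) (monomial (j : Fin r →₀ ℕ) 1) :=
    fun j => Module.Basis.mk_apply _ _ j
  have hmon : ∀ d, Ideal.Quotient.mk (coeffIdeal γ) (monomial d (1 : L)) =
      ∑ j, γ d j • b j := by
    intro d
    rw [Ideal.Quotient.eq.2 (monomial_sub_mem_coeffIdeal γ d), basisPoly,
      Fintype.linearCombination_apply, map_sum]
    exact Finset.sum_congr rfl fun j _ => by rw [hb]; rfl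
  have hmul : ∀ d e : Fin r →₀ ℕ, Ideal.Quotient.mk (coeffIdeal γ) (monomial d (1 : L)) *
      Ideal.Quotient.mk (coeffIdeal γ) (monomial e (1 : L)) =
        Ideal.Quotient.mk (coeffIdeal γ) (monomial (d + e) (1 : L)) := by
    intro d e
    rw [← map_mul, monomial_mul, one_mul]
  have hfin : Module.Finite L B := Module.Finite.of_basis b
  have htr : (Algebra.traceMatrix L b).det ≠ 0 := by
    convert hdisc using 1
    rw [coeffDiscr]
    congr 1
    ext j j'
    rw [Algebra.traceMatrix_apply, Algebra.traceForm_apply, Algebra.trace_eq_matrix_trace b,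
      Matrix.trace, Matrix.of_apply]
    refine Finset.sum_congr rfl fun l _ => ?_
    rw [Matrix.diag_apply, Algebra.leftMulMatrix_eq_repr_mul, hb, hb, hb, hmul, hmul, hmon,
      ← Module.Basis.equivFun_apply, ← Module.Basis.equivFun_symm_apply, LinearEquiv.apply_symm_apply]
  have : IsReduced B := isReduced_of_traceMatrix_det_ne_zero b htr
  obtain ⟨e⟩ := exists_equiv_algHom b
  let q : β.monos → Fin r → L := fun p i => e p (Ideal.Quotient.mk _ (X i))
  have hval : ∀ p d, monomialValue (q p) d =
      e p (Ideal.Quotient.mk (coeffIdeal γ) (monomial d (1 : L))) := by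
    intro p d
    have : monomial d (1 : L) = ∏ i, X i ^ d i := by
      rw [monomial_eq, map_one, one_mul, Finsupp.prod_fintype _ _ fun i => pow_zero _]
    rw [this, map_prod, map_prod]
    simp [monomialValue, q]
  refine ⟨q, ?_, fun d p => ?_⟩
  · rw [isUnit_iff_ne_zero]
    intro h0
    obtain ⟨w, hw0, hw⟩ := Matrix.exists_vecMul_eq_zero_iff.2 h0
    -- A relation between the rows of values is an element of `B` killed by all characters.
    have hsum : ∑ j, w j • b j = 0 := by
      refine eq_zero_of_forall_algHom_eq_zero (L := L) fun χ => ?_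
      obtain ⟨p, rfl⟩ := e.surjective χ
      have := congrFun hw p
      rw [map_sum]
      simpa [Matrix.vecMul, dotProduct, valueMatrix, hval, ← hb] using this
    exact hw0 (funext fun j => Fintype.linearIndependent_iff.1 b.linearIndependent w hsum j)
  · rw [hval, hmon, map_sum]
    refine Finset.sum_congr rfl fun j _ => ?_
    rw [hval, ← hb, map_smul, smul_eq_mul]

end Reduced

/-! ### The principal component is a minimal prime -/

section MinimalPrime

variable {K : Type u} [Field K] [Infinite K] {r : ℕ} {β : BasisSet r}

/-- On the generic family the discriminant is the square of the determinant, a unit. -/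
theorem coeffDiscr_notMem_principalComponent :
    coeffDiscr (universalCoeff K β) ∉ principalComponent K β := by
  intro h
  have hdiscr : (genericMap K β : CoordRing K β →+* GenericRing K β)
      (coeffDiscr (universalCoeff K β)) = 0 := h
  rw [map_coeffDiscr] at hdiscr
  have hd := (vanishesAt_genericMap K β).coeffDiscr_eq (isUnit_det_indetPoint K β)
  exact ((isUnit_det_indetPoint K β).pow 2).ne_zero (hd.symm.trans hdiscr)

/-- The principal component is an irreducible component. -/
theorem eq_principalComponent_of_le {Q : Ideal (CoordRing K β)} [Q.IsPrime]
    (hQ : Q ≤ principalComponent K β) : Q = principalComponent K β := by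
  refine le_antisymm hQ ?_
  -- `ψ` is the geometric generic point of the locus of `Q`. The discriminant is not in `Q`, so the
  -- family there comes from points and lies on the principal component.
  let F := FractionRing (CoordRing K β ⧸ Q)
  let L := AlgebraicClosure F
  let ψ : CoordRing K β →ₐ[K] L :=
    ((IsScalarTower.toAlgHom K F L).comp (IsScalarTower.toAlgHom K (CoordRing K β ⧸ Q) F)).comp
      (Ideal.Quotient.mkₐ K Q)
  have hker : ∀ f, ψ f = 0 → f ∈ Q := by
    intro f hf
    have h₁ : algebraMap F L (algebraMap (CoordRing K β ⧸ Q) F (Ideal.Quotient.mk Q f)) = 0 := hf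
    rw [map_eq_zero_iff _ (algebraMap F L).injective,
      map_eq_zero_iff _ (IsFractionRing.injective (CoordRing K β ⧸ Q) F)] at h₁
    exact Ideal.Quotient.eq_zero_iff_mem.1 h₁
  have hs := (isCoeffSystem_universalCoeff K β).map (ψ : CoordRing K β →+* L)
  obtain ⟨q, hq, hvan⟩ := hs.exists_points <| by
    rw [← map_coeffDiscr]
    exact fun h0 => coeffDiscr_notMem_principalComponent (hQ (hker _ h0))
  intro f hf
  exact hker f (principalComponent_le_ker hq ψ hvan hf)

end MinimalPrime

/-! ### The dimension at `t_β` -/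

section Dimension

/-- Noether normalizations compute the transcendence degree, also of algebraic extensions. -/
theorem trdeg_eq_of_isIntegral {K D E : Type u} [Field K] [CommRing D] [IsDomain D] [Algebra K D]
    [CommRing E] [IsDomain E] [Algebra K E] [Algebra D E] [IsScalarTower K D E]
    [FaithfulSMul D E] [Algebra.IsAlgebraic D E] {s : ℕ} (g : MvPolynomial (Fin s) K →ₐ[K] D)
    (hg : Function.Injective g) (hgi : g.IsIntegral) : Algebra.trdeg K E = s := by
  algebraize [g.toRingHom]
  have : IsScalarTower K (MvPolynomial (Fin s) K) D :=
    IsScalarTower.of_algebraMap_eq fun x => (g.commutes x).symm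
  have : Algebra.IsIntegral (MvPolynomial (Fin s) K) D := ⟨hgi⟩
  have : FaithfulSMul (MvPolynomial (Fin s) K) D :=
    (faithfulSMul_iff_algebraMap_injective _ _).2 hg
  rw [← trdeg_add_eq K D (A := E), ← trdeg_add_eq K (MvPolynomial (Fin s) K) (A := D),
    trdeg_eq_zero (R := D), trdeg_eq_zero (R := MvPolynomial (Fin s) K)]
  simp

variable {K : Type u} [Field K] {r : ℕ} {β : BasisSet r}

theorem trdeg_genericRing [Infinite K] :
    Algebra.trdeg K (GenericRing K β) = (r * β.monos.card : ℕ) := by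
  have : Algebra.IsAlgebraic (MvPolynomial (β.monos × Fin r) K) (GenericRing K β) :=
    IsLocalization.isAlgebraic _ (Submonoid.powers (genericDet K β))
  have : FaithfulSMul (MvPolynomial (β.monos × Fin r) K) (GenericRing K β) :=
    (faithfulSMul_iff_algebraMap_injective _ _).2 (IsLocalization.injective _
      (powers_le_nonZeroDivisors_of_noZeroDivisors genericDet_ne_zero))
  rw [← trdeg_add_eq K (MvPolynomial (β.monos × Fin r) K) (A := GenericRing K β),
    trdeg_eq_zero (R := MvPolynomial (β.monos × Fin r) K)]
  simp [mul_comm]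

/-- The coordinates of points are eigenvalues of the multiplication by coordinates, and so integral
over the coefficients. -/
theorem VanishesAt.isIntegralElem {A E : Type*} [CommRing A] [CommRing E] [IsDomain E]
    (φ : A →+* E) {γ : (Fin r →₀ ℕ) → β.monos → A} {q : β.monos → Fin r → E}
    (h : VanishesAt (fun d j => φ (γ d j)) q) (p : β.monos) (i : Fin r) :
    φ.IsIntegralElem (q p i) := by
  let N : Matrix β.monos β.monos A :=
    Matrix.of fun j l => γ ((j : Fin r →₀ ℕ) + Finsupp.single i 1) l
  refine ⟨N.charpoly, N.charpoly_monic, ?_⟩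
  rw [← Polynomial.eval_map, ← Matrix.charpoly_map, Matrix.eval_charpoly,
    ← Matrix.exists_mulVec_eq_zero_iff]
  -- The values of the monomials of `β` form an eigenvector for `q p i`; it is nonzero since its
  -- entry at `1` is `1`.
  refine ⟨fun j => monomialValue (q p) (j : Fin r →₀ ℕ), fun h0 => ?_, funext fun j => ?_⟩
  · have := congrFun h0 ⟨0, β.zero_mem⟩
    simp [monomialValue_zero] at this
  · have := h ((j : Fin r →₀ ℕ) + Finsupp.single i 1) p
    rw [monomialValue_add, monomialValue_single] at this
    rw [Matrix.sub_mulVec, Pi.sub_apply, Pi.zero_apply, sub_eq_zero]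
    simp only [Matrix.scalar_apply, Matrix.mulVec, dotProduct,
      Matrix.map_apply, N, Matrix.of_apply]
    rw [this]
    simp [Matrix.diagonal_apply, mul_comm]

/-- A domain of finite type through which the generic family factors, injectively in the second
step, has dimension `rn` at every closed point. -/
theorem height_eq_of_isMaximal_of_comp_eq_genericMap [Infinite K] {D : Type u} [CommRing D]
    [IsDomain D] [Algebra K D] [Algebra.FiniteType K D] (ψ : CoordRing K β →ₐ[K] D)
    (φ : D →ₐ[K] GenericRing K β) (hφ : Function.Injective φ) (hφψ : φ.comp ψ = genericMap K β)
    (m : Ideal D) [m.IsMaximal] : m.height = (r * β.monos.card : ℕ) := by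
  let E := GenericRing K β
  have hnoeth : IsNoetherianRing D := Algebra.FiniteType.isNoetherianRing K D
  let : Algebra D E := φ.toRingHom.toAlgebra
  have : IsScalarTower K D E := IsScalarTower.of_algebraMap_eq fun x => (φ.commutes x).symm
  have : FaithfulSMul D E := (faithfulSMul_iff_algebraMap_injective _ _).2 hφ
  have hpt : ∀ p i, IsAlgebraic D (indetPoint K β p i) := fun p i => by
    refine IsIntegral.isAlgebraic (VanishesAt.isIntegralElem (algebraMap D E)
      (γ := fun d j => ψ (universalCoeff K β d j)) ?_ p i)
    have h := vanishesAt_genericMap K β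
    rw [← hφψ] at h
    exact h
  have hpoly : ∀ a : MvPolynomial (β.monos × Fin r) K,
      algebraMap _ E a ∈ Subalgebra.algebraicClosure D E := by
    intro a
    induction a using MvPolynomial.induction_on with
    | C c =>
      have : algebraMap (MvPolynomial (β.monos × Fin r) K) E (C c) =
          algebraMap D E (algebraMap K D c) := by
        rw [← IsScalarTower.algebraMap_apply K D E, ← MvPolynomial.algebraMap_eq,
          ← IsScalarTower.algebraMap_apply]
      rw [this]
      exact Subalgebra.algebraMap_mem _ _
    | add a b ha hb => rw [map_add]; exact add_mem ha hb
    | mul_X a x ha => rw [map_mul]; exact mul_mem ha (hpt x.1 x.2)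
  have halg : Algebra.IsAlgebraic D E := by
    refine ⟨fun x => ?_⟩
    obtain ⟨⟨a, u⟩, hx⟩ := IsLocalization.surj (Submonoid.powers (genericDet K β)) x
    have hu := IsLocalization.map_units E u
    refine IsAlgebraic.of_mul (y := algebraMap _ E (u : MvPolynomial (β.monos × Fin r) K))
      hu.mem_nonZeroDivisors (hpoly _) ?_
    rw [mul_comm, hx]
    exact hpoly a
  -- Noether normalization: `E` is algebraic over `D`, so the number `s` of variables is the
  -- transcendence degree `rn` of `E`.
  obtain ⟨s, g, hg, hgi⟩ := exists_integral_inj_algHom_of_fg K D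
  have hs : s = r * β.monos.card := by
    have h₁ := trdeg_eq_of_isIntegral (E := E) g hg hgi
    rw [trdeg_genericRing] at h₁
    exact_mod_cast h₁.symm
  rw [← hs]
  exact Ideal.height_eq_of_isIntegral g hg hgi m

theorem originPoint_surjective : Function.Surjective (originPoint K β) := fun c =>
  ⟨algebraMap K _ c, AlgHom.commutes _ c⟩

instance originIdeal_isMaximal : (originIdeal K β).IsMaximal :=
  RingHom.ker_isMaximal_of_surjective _ originPoint_surjective

instance isNoetherianRing_coordRing : IsNoetherianRing (CoordRing K β) :=
  Algebra.FiniteType.isNoetherianRing K _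

theorem height_map_originIdeal [Infinite K] :
    ((originIdeal K β).map (Ideal.Quotient.mk (principalComponent K β))).height =
      (r * β.monos.card : ℕ) := by
  have : ((originIdeal K β).map (Ideal.Quotient.mk (principalComponent K β))).IsMaximal :=
    Ideal.IsMaximal.map_of_surjective_of_ker_le Ideal.Quotient.mk_surjective
      (by rw [Ideal.mk_ker]; exact principalComponent_le_originIdeal)
  have : Algebra.FiniteType K (CoordRing K β ⧸ principalComponent K β) :=
    Algebra.FiniteType.of_surjective (Ideal.Quotient.mkₐ K (principalComponent K β))
      Ideal.Quotient.mk_surjective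
  exact height_eq_of_isMaximal_of_comp_eq_genericMap
    (Ideal.Quotient.mkₐ K (principalComponent K β)) (Ideal.kerLiftAlg (genericMap K β))
    (Ideal.kerLiftAlg_injective _) (AlgHom.ext fun _ => rfl) _

/-- The monomial ideal lies on the principal component, which has dimension `rn`. -/
theorem le_height_originIdeal [Infinite K] :
    ((r * β.monos.card : ℕ) : ℕ∞) ≤ (originIdeal K β).height := by
  rw [← height_map_originIdeal (K := K) (β := β)]
  exact Ideal.height_map_quotient_le principalComponent_le_originIdeal

/-- If the local ring is a domain, the monomial ideal lies on no other component. -/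
theorem height_originIdeal_le [Infinite K]
    [IsDomain (Localization.AtPrime (originIdeal K β))] :
    (originIdeal K β).height ≤ ((r * β.monos.card : ℕ) : ℕ∞) := by
  let L := Localization.AtPrime (originIdeal K β)
  -- `Q` lies in every prime inside `M` and is prime when `R_M` is a domain; minimality of the
  -- principal component identifies the two.
  let Q : Ideal (CoordRing K β) := RingHom.ker (algebraMap (CoordRing K β) L)
  have hQprime : Q.IsPrime := RingHom.ker_isPrime _
  have hQ : ∀ p : Ideal (CoordRing K β), p.IsPrime → p ≤ originIdeal K β → Q ≤ p := by
    intro p hp hpM f hf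
    have hf' : algebraMap (CoordRing K β) L f = 0 := hf
    obtain ⟨u, hu⟩ := (IsLocalization.map_eq_zero_iff (originIdeal K β).primeCompl L f).1 hf'
    have hmem : (u : CoordRing K β) * f ∈ p := hu ▸ p.zero_mem
    exact (hp.mem_or_mem hmem).resolve_left fun h => u.2 (hpM h)
  have hQP : Q = principalComponent K β := eq_principalComponent_of_le
    (hQ _ inferInstance principalComponent_le_originIdeal)
  rw [← height_map_originIdeal (K := K) (β := β), ← hQP]
  exact Ideal.height_le_height_map_quotient hQ

end Dimension

/-! ### The criterion for nonsingularity -/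

section Main

variable {K : Type u} [Field K] [IsAlgClosed K] {r : ℕ} {β : BasisSet r}

/-- The bunch has `rn` elements and `M` has height at least `rn`, so a spanning bunch makes `R_M`
regular. If `R_M` is regular, it is a domain, the height is at most `rn`, and so is `dim M/M²`;
independence of the bunch then gives spanning. -/
theorem BasisSet.IsStandardBunch.isNonsingularPoint_iff {S : Set (Arrow β)}
    (h : β.IsStandardBunch S) :
    IsNonsingularPoint K β ↔ Submodule.span K (arrowClass K '' S) = ⊤ := by
  have hdim := IsLocalization.AtPrime.ringKrullDim_eq_height (originIdeal K β)
    (Localization.AtPrime (originIdeal K β))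
  constructor
  · intro hreg
    have hreg' : IsRegularLocalRing (Localization.AtPrime (originIdeal K β)) := hreg
    have := IsRegularLocalRing.isDomain (Localization.AtPrime (originIdeal K β))
    have hrank := hreg'.spanFinrank_maximalIdeal
    rw [hdim] at hrank
    have hrank' : ((IsLocalRing.maximalIdeal
        (Localization.AtPrime (originIdeal K β))).spanFinrank : ℕ∞) ≤ (r * β.monos.card : ℕ) := by
      refine le_trans (le_of_eq ?_) (height_originIdeal_le (K := K) (β := β))
      exact_mod_cast hrank
    obtain ⟨t, htfin, htcard, htspan⟩ := exists_span_cotangent_eq_top (K := K)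
      (M := originIdeal K β) fun f => ⟨originPoint K β f, by
        change originPoint K β _ = 0
        rw [map_sub, AlgHom.commutes]
        exact sub_self _⟩
    have htcard' : t.ncard ≤ S.ncard := by
      rw [h.ncard_eq]
      exact htcard.trans (by exact_mod_cast hrank')
    have := htfin.fintype
    have := h.finite.fintype
    have : FiniteDimensional K (originIdeal K β).Cotangent :=
      Module.finite_def.2 ⟨htfin.toFinset, by simpa using htspan⟩
    have hle : Module.finrank K (originIdeal K β).Cotangent ≤ S.ncard := by
      rw [← finrank_top, ← htspan]
      refine (finrank_span_le_card t).trans ?_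
      rwa [← Set.ncard_eq_toFinset_card']
    have hli := h.linearIndependent (K := K)
    have hge := hli.fintype_card_le_finrank
    have hcardS : Fintype.card S = S.ncard := by
      rw [← Nat.card_eq_fintype_card, Nat.card_coe_set_eq]
    have := hli.span_eq_top_of_card_eq_finrank' (by omega)
    rwa [← Set.image_eq_range] at this
  · intro hspan
    refine IsRegularLocalRing.of_spanFinrank_maximalIdeal_le _ ?_
    rw [hdim]
    let ι : Arrow β → originIdeal K β := fun a => ⟨arrowFn K a, arrowFn_mem K a⟩
    have hle := spanFinrank_maximalIdeal_le_of_span_eq_top (K := K) (s := ι '' S)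
      (h.finite.image _) (by rw [Set.image_image]; exact hspan)
    have hle' := (hle.trans (Set.ncard_image_le h.finite)).trans_eq h.ncard_eq
    have hle'' : ((IsLocalRing.maximalIdeal
        (Localization.AtPrime (originIdeal K β))).spanFinrank : ℕ∞) ≤ (originIdeal K β).height :=
      le_trans (by exact_mod_cast hle') (le_height_originIdeal (K := K) (β := β))
    exact_mod_cast hle''

end Main

theorem mainTheorem1 {K : Type u} [Field K] [IsAlgClosed K] {r : ℕ} (β : BasisSet r) :
    -- `R` is the coordinate ring of `U_β`, and `t_β` is the point corresponding to `I_β`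
    IsUniversalFamily K β (CoordRing K β) (universalIdeal K β) ∧
    (universalIdeal K β).map (MvPolynomial.map (originPoint K β : CoordRing K β →+* K)) =
      monomialIdeal K β ∧
    -- iterated shadow promotion produces a set of arrows
    (∃ S : Set (Arrow β), β.IsStandardBunch S) ∧
    -- every set so produced has the asserted properties
    (∀ S : Set (Arrow β), β.IsStandardBunch S →
      (∀ a ∈ S, a.IsMinimal ∧ a.IsStandard) ∧
      S.Finite ∧ S.ncard = r * β.monos.card ∧
      LinearIndependent K (fun a : S => arrowClass K (a : Arrow β)) ∧
      (IsNonsingularPoint K β ↔ Submodule.span K (arrowClass K '' S) = ⊤)) ∧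
    ((r * β.monos.card : ℕ) : Cardinal) ≤ Module.rank K (originIdeal K β).Cotangent := by
  refine ⟨isUniversalFamily_universalIdeal, universalIdeal_map_originPoint,
    β.exists_isStandardBunch, fun S hS => ⟨fun a ha => hS.isMinimal_and_isStandard ha, hS.finite,
      hS.ncard_eq, hS.linearIndependent, hS.isNonsingularPoint_iff⟩, ?_⟩
  obtain ⟨S, hS⟩ := β.exists_isStandardBunch
  have h := (hS.linearIndependent (K := K)).cardinal_lift_le_rank
  rw [← hS.ncard_eq]
  have := hS.finite.fintype
  rw [← Nat.card_coe_set_eq, Nat.card_eq_fintype_card]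
  rw [Cardinal.mk_fintype] at h
  simpa using h
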